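/- **Theorem 3.** Let $\nu>-\tfrac12$, let $\rho_\nu(x)=2x^{\nu/2}K_\nu(2\sqrt x)$ for $x>0$, where $K_\nu$ is the Macdonald (modified Bessel) function, and let $(P_n)_{n\ge 0}$ be a sequence of real polynomials with $\deg P_n=n$ and $$\int_0^\infty P_m(x)P_n(x)\rho_\nu^2(x)\,dx=\delta_{m,n},\qquad m,n\in\mathbb N_0 .$$ Let $(a)_k$ be the Pochhammer symbol, $L_r^\nu$ the generalized Laguerre polynomials, $\theta=tDt$ with $D=d/dt$, $\Gamma(a,t)=\int_t^\infty e^{-u}u^{a-1}du$ the incomplete gamma function, and put, for $k,m,r\in\mathbb N_0$, $$c_{k,r}=\frac{r!}{\Gamma(1+\nu+r)}\int_0^\infty t^\nu e^{-t}L_r^\nu(t)\,\theta^k\!\left(t^\nu e^t\,\Gamma(-\nu,t)\right)dt,\qquad d_{m,r}=\int_0^\infty t^{\nu+m}e^{-t}L_m^\nu(t)L_r^\nu(t)\,dt,$$ $$f_{k,m}=\sum_{r=0}^{2m}c_{k,r}\,d_{m,r}.$$ Let $D_n=\det\left(f_{j,m}\right)_{0\le m\le n-1,\ 1\le j\le n}$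 (with $D_0=1$), for $1\le k\le n$ let $D_{n,k}$ be the determinant obtained from $D_n$ by replacing its $k$-th column $(f_{k,m})_{0\le m\le n-1}$ by $(f_{0,m})_{0\le m\le n-1}$, and let $D_{n,0}=-D_n$. Put $$S_n=\sqrt\pi\,\frac{\Gamma(1+2\nu)\Gamma(1+\nu)}{2^{1+2\nu}\,\Gamma(\nu+3/2)}\sum_{k=0}^n D_{n,k}\,(n+k)!\,\frac{(1+2\nu)_{n+k}(1+\nu)_{n+k}}{4^{n+k}(\nu+3/2)_{n+k}} .$$ Then $\rho_\nu$ is positive and infinitely differentiable on $(0,\infty)$, and for every $n\in\mathbb N_0$ one has $D_n\ne0$, $D_{n,n}S_n>0$, and there is a sign $\sigma\in\{1,-1\}$ such that the free coefficient of $P_n$ is $$a_{n,0}=\sigma\,\frac{D_n}{\sqrt{D_{n,n}S_n}},$$ the leading coefficient of $P_n$ is positive if and only if $\sigma D_{n,n}<0$, and for all $x>0$ the Rodrigues-type formula $$P_n(x)=-\frac{a_{n,0}}{D_n\,\rho_\nu(x)}\sum_{r=0}^n D_{n,r}\,r!\,(1+\nu)_r\sum_{k=0}^{2r}\frac1{k!}\,\frac{d^k}{dx^k}\!\left(x^k\rho_\nu(x)\right)\,{}_3F_2\!\left(-k,\,1+\nu+r,\,1+r;\,1+\nu,\,1;\,1\right)$$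 holds. -/

import Mathlib

open Set MeasureTheory Polynomial

open scoped Nat ContDiff

noncomputable section

namespace MacdonaldSq

/-- The Macdonald (modified Bessel) function
`K_ν(z) = ∫_0^∞ exp(-z cosh u) cosh(ν u) du`, for `z > 0`. -/
def macdonaldK (ν z : ℝ) : ℝ :=
  ∫ u in Ioi (0 : ℝ), Real.exp (-z * Real.cosh u) * Real.cosh (ν * u)

/-- The function `ρ_ν(x) = 2 x^{ν/2} K_ν(2√x)`, for `x > 0`. -/
def rho (ν x : ℝ) : ℝ :=
  2 * x ^ (ν / 2) * macdonaldK ν (2 * √x)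

/-- `P` is a sequence of real orthonormal polynomials for the weight `ρ_ν²` on `(0, ∞)`,
with `P n` of exact degree `n`. -/
structure IsOrthonormalSeq (ν : ℝ) (P : ℕ → ℝ[X]) : Prop where
  degree_eq : ∀ n, (P n).degree = n
  orthonormal : ∀ m n,
    ∫ x in Ioi (0 : ℝ), (P m).eval x * (P n).eval x * rho ν x ^ 2 = if m = n then 1 else 0

/-- The Pochhammer symbol `(a)_k = a (a + 1) ⋯ (a + k - 1)`. -/
def poch (a : ℝ) (k : ℕ) : ℝ := (ascPochhammer ℝ k).eval a

/-- The generalized hypergeometric series `₃F₂(a₁, a₂, a₃; b₁, b₂; z)`. -/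
def hyp3F2 (a₁ a₂ a₃ b₁ b₂ z : ℝ) : ℝ :=
  ∑' j : ℕ, poch a₁ j * poch a₂ j * poch a₃ j / (poch b₁ j * poch b₂ j * (j ! : ℝ)) * z ^ j

/-- The generalized Laguerre polynomial
`L_n^ν(t) = ∑_{i ≤ n} binom(n + ν, n - i) (-t)^i / i!`,
where `binom(n + ν, n - i) = (ν + i + 1)_{n - i} / (n - i)!`. -/
def laguerre (ν : ℝ) (n : ℕ) (t : ℝ) : ℝ :=
  ∑ i ∈ Finset.range (n + 1),
    poch (ν + i + 1) (n - i) / ((n - i)! : ℝ) * (-t) ^ i / (i ! : ℝ)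

/-- The upper incomplete gamma function `Γ(a, z) = ∫_z^∞ e^{-u} u^{a-1} du`, for `z > 0`. -/
def upperGamma (a z : ℝ) : ℝ :=
  ∫ u in Ioi z, Real.exp (-u) * u ^ (a - 1)

/-- The operator `θ = t D t`, that is `(θ g)(t) = t (s g(s))'(t)`. -/
def theta (g : ℝ → ℝ) (t : ℝ) : ℝ :=
  t * deriv (fun s => s * g s) t

/-- The function `φ(t) = t^ν e^t Γ(-ν, t)`, for `t > 0`. -/
def phi (ν t : ℝ) : ℝ :=
  t ^ ν * Real.exp t * upperGamma (-ν) t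

/-- The Laguerre coefficients of `θ^k φ`:
`c_{k,r} = r! / Γ(1+ν+r) ∫_0^∞ t^ν e^{-t} L_r^ν(t) (θ^k φ)(t) dt`. -/
def coefC (ν : ℝ) (k r : ℕ) : ℝ :=
  (r ! : ℝ) / Real.Gamma (1 + ν + r) *
    ∫ t in Ioi (0 : ℝ), t ^ ν * Real.exp (-t) * laguerre ν r t * (theta^[k] (phi ν)) t

/-- `d_{m,r} = ∫_0^∞ t^{ν+m} e^{-t} L_m^ν(t) L_r^ν(t) dt`. -/
def coefD (ν : ℝ) (m r : ℕ) : ℝ :=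
  ∫ t in Ioi (0 : ℝ), t ^ (ν + m) * Real.exp (-t) * laguerre ν m t * laguerre ν r t

/-- `f_{k,m} = ∑_{r=0}^{2m} c_{k,r} d_{m,r}`. -/
def coefF (ν : ℝ) (k m : ℕ) : ℝ :=
  ∑ r ∈ Finset.range (2 * m + 1), coefC ν k r * coefD ν m r

/-- The `n × n` determinant `D_n`, whose row `m = 0, …, n-1` is `f_{1,m}, …, f_{n,m}`. -/
def detD (ν : ℝ) (n : ℕ) : ℝ :=
  Matrix.det (Matrix.of fun i j : Fin n => coefF ν (j + 1) i)

/-- For `1 ≤ k ≤ n`, `D_{n,k}` is `D_n` with its `k`-th column `(f_{k,m})_m` replaced by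
`(f_{0,m})_m`; moreover `D_{n,0} = -D_n`. -/
def detDk (ν : ℝ) (n k : ℕ) : ℝ :=
  if k = 0 then -detD ν n
  else Matrix.det (Matrix.of fun i j : Fin n =>
    coefF ν (if (j : ℕ) + 1 = k then 0 else j + 1) i)

/-- `√π Γ(1+2ν) Γ(1+ν) / (2^{1+2ν} Γ(ν+3/2))
    ∑_{k=0}^n D_{n,k} (n+k)! (1+2ν)_{n+k} (1+ν)_{n+k} / (4^{n+k} (ν+3/2)_{n+k})`. -/
def normS (ν : ℝ) (n : ℕ) : ℝ :=
  √Real.pi * (Real.Gamma (1 + 2 * ν) * Real.Gamma (1 + ν)) /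
      ((2 : ℝ) ^ (1 + 2 * ν) * Real.Gamma (ν + 3 / 2)) *
    ∑ k ∈ Finset.range (n + 1),
      detDk ν n k * ((n + k)! : ℝ) * (poch (1 + 2 * ν) (n + k) * poch (1 + ν) (n + k)) /
        ((4 : ℝ) ^ (n + k) * poch (ν + 3 / 2) (n + k))

/-- The free coefficient `a_{n,0} = σ D_n / √(D_{n,n} S_n)`, where `σ = ±1` and `S_n` is
`normS ν n`. -/
def freeCoeff (ν : ℝ) (n : ℕ) (σ : ℝ) : ℝ :=
  σ * detD ν n / √(detDk ν n n * normS ν n)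

end MacdonaldSq

end

/-!
The integral representation `ρ_ν(x) = ∫_0^∞ t^{ν-1} e^{-t-x/t} dt` (`rho_eq_rhoInt`) gives
smoothness, positivity, `ρ_a' = -ρ_{a-1}` and `ρ_{a+1} = a ρ_a + x ρ_{a-1}`, and it drives the two
halves of the argument.

*The determinants.* On `e^{-x/t} / t` the operator `θ` in the variable `t` is multiplication by
`x`, and `Γ(1+ν) φ(t)` is the integral of `ρ_ν(x) e^{-x/t} / t` over `x > 0`; hence
`Γ(1+ν) θ^k φ(t) = ∫ x^k ρ_ν(x) e^{-x/t} / t dx` (`theta_iterate_phi`). By Laguerre expansion of the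
polynomial `t^m L_m^ν(t)`, of degree `2m`, the number `f_{k,m}` is the integral of
`t^{ν+m} e^{-t} L_m^ν(t) θ^k φ(t)` (`coefF_eq_form`). Interchanging the integrations and using that
the transform of `t^{ν+m} e^{-t} L_m^ν(t)` is `(-1)^m x^m ρ_ν(x) / m!` (`pow_mul_rho_eq_sum`) gives
`Γ(1+ν) f_{k,m} = (-1)^m / m! ∫ x^{k+m} ρ_ν(x)^2 dx` (`Gamma_mul_coefF`). So `D_n` is, up to row
factors, a Gram determinant of the weight `x ρ_ν(x)^2` and does not vanish (`detD_ne_zero`), and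
orthogonality of `P_n` to `1, …, x^{n-1}` is a linear system that Cramer's rule solves:
`D_n a_{n,k} = -a_{n,0} D_{n,k}` (`detD_mul_coeff`). The moments of `ρ_ν^2` are computed from gamma
integrals (`moment_rho_mul_rho`, `rhoSqMoment_eq`), so that `S_n = ∑ D_{n,k} ∫ x^{n+k} ρ_ν^2`, and
the normalization of `P_n` becomes `a_{n,0}^2 D_{n,n} S_n = D_n^2`.

*The Rodrigues-type formula.* Let `δ = x d/dx`. The differential equation of `ρ_ν` yields
`x^r ρ_ν = (ν - δ)_r (-δ)_r ρ_ν` (`pow_mul_rho_eq_eulerEval`), while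
`(d/dx)^k x^k = (δ + 1) ⋯ (δ + k)`. Newton interpolation of the polynomial `(ν - X)_r (-X)_r` at the
nodes `-1, -2, …` expands it in the products `(X + 1) ⋯ (X + k)`, and the coefficients are the
terminating `₃F₂` values (`newton_interpolation`, `hyp3F2_eq_sum`).
-/

noncomputable section

namespace MacdonaldSq

/-! ### The integral representation of `ρ_ν` -/

/-- The kernel `t^{a-1} e^{-t-x/t}`, whose integral over `t > 0` is `ρ_a(x)`. -/
def rhoKernel (a x t : ℝ) : ℝ := t ^ (a - 1) * Real.exp (-t - x / t)

/-- The integral `∫_0^∞ t^{a-1} e^{-t-x/t} dt`. It agrees with `rho a x` for `x > 0`. -/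
def rhoInt (a x : ℝ) : ℝ := ∫ t in Ioi (0 : ℝ), rhoKernel a x t

lemma measurable_rhoKernel (a x : ℝ) : Measurable (rhoKernel a x) := by
  unfold rhoKernel; fun_prop

lemma rhoKernel_pos (a x : ℝ) {t : ℝ} (ht : 0 < t) : 0 < rhoKernel a x t := by
  unfold rhoKernel; positivity

/-- The factor `e^{-x/t}` beats any negative power of `t`. -/
lemma rhoKernel_le (a : ℝ) {x t : ℝ} (hx : 0 < x) (ht : 0 < t) (N : ℕ) :
    rhoKernel a x t ≤ (N ! : ℝ) / x ^ N * (Real.exp (-t) * t ^ (a + N - 1)) := by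
  have h1 : (x / t) ^ N / N ! ≤ Real.exp (x / t) :=
    Real.pow_div_factorial_le_exp (x / t) (by positivity) N
  have h2 : Real.exp (-(x / t)) ≤ N ! / x ^ N * t ^ N := by
    rw [Real.exp_neg, inv_le_comm₀ (Real.exp_pos _) (by positivity)]
    refine le_trans (le_of_eq ?_) h1
    rw [div_pow]
    field_simp
  have h3 : t ^ (a + N - 1) = t ^ (a - 1) * t ^ N := by
    rw [← Real.rpow_natCast, ← Real.rpow_add ht]; ring_nf
  rw [rhoKernel, show -t - x / t = -t + -(x / t) by ring, Real.exp_add, h3]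
  calc t ^ (a - 1) * (Real.exp (-t) * Real.exp (-(x / t)))
      ≤ t ^ (a - 1) * (Real.exp (-t) * (N ! / x ^ N * t ^ N)) := by gcongr
    _ = _ := by ring

lemma integrableOn_rhoKernel (a : ℝ) {x : ℝ} (hx : 0 < x) :
    IntegrableOn (rhoKernel a x) (Ioi 0) := by
  obtain ⟨N, hN⟩ := exists_nat_gt (-a)
  have h := (Real.GammaIntegral_convergent (s := a + N) (by linarith)).const_mul
    ((N ! : ℝ) / x ^ N)
  refine Integrable.mono' h (measurable_rhoKernel a x).aestronglyMeasurable ?_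
  refine (ae_restrict_mem measurableSet_Ioi).mono fun t (ht : 0 < t) => ?_
  rw [Real.norm_of_nonneg (rhoKernel_pos a x ht).le]
  exact rhoKernel_le a hx ht N

lemma rhoInt_pos (a : ℝ) {x : ℝ} (hx : 0 < x) : 0 < rhoInt a x := by
  unfold rhoInt
  rw [setIntegral_pos_iff_support_of_nonneg_ae _ (integrableOn_rhoKernel a hx)]
  · have : Function.support (rhoKernel a x) ∩ Ioi 0 = Ioi 0 :=
      inter_eq_right.2 fun t ht => (rhoKernel_pos a x ht).ne'
    rw [this]; simp
  · exact (ae_restrict_mem measurableSet_Ioi).mono fun t ht => (rhoKernel_pos a x ht).le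

lemma hasDerivAt_rhoInt (a : ℝ) {x : ℝ} (hx : 0 < x) :
    HasDerivAt (rhoInt a) (-rhoInt (a - 1) x) x := by
  have hx2 : 0 < x / 2 := by linarith
  have key := (hasDerivAt_integral_of_dominated_loc_of_deriv_le
    (μ := volume.restrict (Ioi 0)) (F := fun y t => rhoKernel a y t)
    (F' := fun y t => -rhoKernel (a - 1) y t) (bound := rhoKernel (a - 1) (x / 2)) (x₀ := x)
    (s := Ioi (x / 2)) (Ioi_mem_nhds (by linarith))
    (Filter.Eventually.of_forall fun y => (measurable_rhoKernel a y).aestronglyMeasurable)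
    (integrableOn_rhoKernel a hx) (measurable_rhoKernel (a - 1) x).neg.aestronglyMeasurable
    ?_ (integrableOn_rhoKernel (a - 1) hx2) ?_).2
  · rw [integral_neg] at key
    exact key
  · refine (ae_restrict_mem measurableSet_Ioi).mono fun t (ht : 0 < t) y (hy : x / 2 < y) => ?_
    rw [norm_neg, Real.norm_of_nonneg (rhoKernel_pos _ y ht).le]
    unfold rhoKernel
    gcongr
  · refine (ae_restrict_mem measurableSet_Ioi).mono fun t (ht : 0 < t) y _ => ?_
    have h1 : HasDerivAt (fun y : ℝ => -t - y / t) (-(1 / t)) y := by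
      simpa using ((hasDerivAt_id y).div_const t).const_sub (-t)
    refine (h1.exp.const_mul (t ^ (a - 1))).congr_deriv ?_
    rw [rhoKernel, Real.rpow_sub_one ht.ne' (a - 1)]
    ring

lemma contDiffOn_rhoInt (a : ℝ) : ContDiffOn ℝ ∞ (rhoInt a) (Ioi 0) := by
  rw [contDiffOn_infty]
  intro n
  induction n generalizing a with
  | zero =>
    exact contDiffOn_zero.2 fun x hx =>
      (hasDerivAt_rhoInt a hx).continuousAt.continuousWithinAt
  | succ n ih =>
    rw [Nat.cast_add, Nat.cast_one, contDiffOn_succ_iff_deriv_of_isOpen isOpen_Ioi]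
    refine ⟨fun x hx => (hasDerivAt_rhoInt a hx).differentiableAt.differentiableWithinAt,
      by simp, ?_⟩
    exact (ih (a - 1)).neg.congr fun x hx => (hasDerivAt_rhoInt a hx).deriv

/-- Integration of `d/dt (t^a e^{-t-x/t})` over `t > 0`. -/
lemma rhoInt_add_one (a : ℝ) {x : ℝ} (hx : 0 < x) :
    rhoInt (a + 1) x = a * rhoInt a x + x * rhoInt (a - 1) x := by
  have hd : ∀ t ∈ Ioi (0 : ℝ), HasDerivAt (rhoKernel (a + 1) x)
      (a * rhoKernel a x t + x * rhoKernel (a - 1) x t - rhoKernel (a + 1) x t) t := by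
    intro t (ht : 0 < t)
    have h1 : HasDerivAt (fun t : ℝ => -t - x / t) (-1 + x / t ^ 2) t := by
      refine ((hasDerivAt_id t).neg.sub
        ((hasDerivAt_const t x).div (hasDerivAt_id t) ht.ne')).congr_deriv ?_
      simp only [id]; ring
    refine ((Real.hasDerivAt_rpow_const (x := t) (p := a + 1 - 1) (Or.inl ht.ne')).mul
      h1.exp).congr_deriv ?_
    simp only [rhoKernel, add_sub_cancel_right]
    rw [Real.rpow_sub_one ht.ne' (a - 1), Real.rpow_sub_one ht.ne' a]
    field_simp
    ring
  have i0 := (integrableOn_rhoKernel a hx).const_mul a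
  have i1 := (integrableOn_rhoKernel (a - 1) hx).const_mul x
  have i2 := integrableOn_rhoKernel (a + 1) hx
  have hi : IntegrableOn (fun t => a * rhoKernel a x t + x * rhoKernel (a - 1) x t
      - rhoKernel (a + 1) x t) (Ioi 0) := (i0.add i1).sub i2
  have htop : Filter.Tendsto (rhoKernel (a + 1) x) Filter.atTop (nhds 0) :=
    tendsto_zero_of_hasDerivAt_of_integrableOn_Ioi hd hi i2
  have hzero : Filter.Tendsto (rhoKernel (a + 1) x) (nhdsWithin 0 (Ioi 0)) (nhds 0) := by
    obtain ⟨N, hN⟩ := exists_nat_gt (-a)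
    have hc : Filter.Tendsto
        (fun t : ℝ => (N ! : ℝ) / x ^ N * (Real.exp (-t) * t ^ (a + 1 + N - 1)))
        (nhdsWithin 0 (Ioi 0)) (nhds 0) := by
      have : ContinuousAt (fun t : ℝ => (N ! : ℝ) / x ^ N * (Real.exp (-t) * t ^ (a + 1 + N - 1)))
          0 := by
        refine continuousAt_const.mul (ContinuousAt.mul (by fun_prop) ?_)
        exact Real.continuousAt_rpow_const _ _ (Or.inr (by linarith))
      refine (this.tendsto.mono_left nhdsWithin_le_nhds).trans (le_of_eq ?_)
      rw [Real.zero_rpow (by linarith)]; simp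
    refine tendsto_of_tendsto_of_tendsto_of_le_of_le' tendsto_const_nhds hc ?_ ?_
    · exact Filter.eventually_of_mem self_mem_nhdsWithin fun t ht => (rhoKernel_pos _ x ht).le
    · exact Filter.eventually_of_mem self_mem_nhdsWithin fun t ht => rhoKernel_le _ hx ht N
  have h0 := integral_Ioi_deriv_mul_eq_sub (u := rhoKernel (a + 1) x) (v := fun _ => (1 : ℝ))
    (v' := fun _ => 0) hd (fun t _ => hasDerivAt_const t 1)
    (by simpa [Pi.add_def, Pi.mul_def] using hi) (a' := 0) (b' := 0)
    (by simpa [Pi.mul_def] using hzero) (by simpa [Pi.mul_def] using htop)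
  simp only [mul_one, mul_zero, add_zero, sub_zero] at h0
  have e1 := integral_sub (i0.add i1) i2
  have e2 := integral_add i0 i1
  simp only [Pi.add_apply, integral_const_mul] at e1 e2
  rw [e1, e2] at h0
  unfold rhoInt
  linarith

/-- The substitution `t = √x e^u` turns `K_ν` into the integral `rhoInt`. -/
lemma rho_eq_rhoInt (a : ℝ) {x : ℝ} (hx : 0 < x) : rho a x = rhoInt a x := by
  have hs : 0 < √x := Real.sqrt_pos.2 hx
  set h : ℝ → ℝ := fun u => Real.exp (-(2 * √x) * Real.cosh u) * Real.exp (a * u) with hh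
  have himg : (fun u => √x * Real.exp u) '' univ = Ioi 0 := by
    ext t
    simp only [image_univ, mem_range, mem_Ioi]
    refine ⟨fun ⟨u, hu⟩ => hu ▸ by positivity, fun ht => ⟨Real.log (t / √x), ?_⟩⟩
    rw [Real.exp_log (by positivity)]
    field_simp
  have hder : ∀ u ∈ (univ : Set ℝ), HasDerivWithinAt (fun u => √x * Real.exp u)
      (√x * Real.exp u) univ u := fun u _ =>
    ((Real.hasDerivAt_exp u).const_mul _).hasDerivWithinAt
  have hinj : InjOn (fun u => √x * Real.exp u) univ := fun u _ v _ huv =>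
    Real.exp_injective (mul_left_cancel₀ hs.ne' huv)
  have hval : ∀ u : ℝ, |√x * Real.exp u| • rhoKernel a x (√x * Real.exp u)
      = x ^ (a / 2) * h u := by
    intro u
    have hxx : x = √x * √x := (Real.mul_self_sqrt hx.le).symm
    have e1 : -(√x * Real.exp u) - x / (√x * Real.exp u) = -(2 * √x) * Real.cosh u := by
      rw [Real.cosh_eq, Real.exp_neg]
      nth_rw 2 [hxx]
      field_simp
      ring
    have e2 : √x * Real.exp u * (√x * Real.exp u) ^ (a - 1) = x ^ (a / 2) * Real.exp (a * u) := by
      rw [Real.rpow_sub_one (by positivity), mul_div_cancel₀ _ (by positivity),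
        Real.mul_rpow hs.le (Real.exp_pos _).le, ← Real.exp_mul, Real.sqrt_eq_rpow,
        ← Real.rpow_mul hx.le]
      ring_nf
    rw [abs_of_pos (by positivity), smul_eq_mul, rhoKernel, e1, ← mul_assoc, e2, hh]
    ring
  have hint : Integrable h := by
    have h1 := (integrableOn_image_iff_integrableOn_abs_deriv_smul MeasurableSet.univ hder hinj
      (rhoKernel a x)).1 (himg ▸ integrableOn_rhoKernel a hx)
    simp only [hval, integrableOn_univ] at h1
    exact (integrable_const_mul_iff (IsUnit.mk0 _ (by positivity)) h).1 h1
  have hR : rhoInt a x = x ^ (a / 2) * ∫ u, h u := by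
    have h1 := integral_image_eq_integral_abs_deriv_smul MeasurableSet.univ hder hinj
      (rhoKernel a x)
    rw [himg] at h1
    simp only [hval, setIntegral_univ, integral_const_mul] at h1
    exact h1
  have heven : ∫ u, h u = 2 * macdonaldK a (2 * √x) := by
    rw [macdonaldK, ← integral_comp_abs]
    have h2 : ∫ u, h (-u) = ∫ u, h u := integral_neg_eq_self h volume
    have h3 : ∀ u : ℝ, Real.exp (-(2 * √x) * Real.cosh |u|) * Real.cosh (a * |u|)
        = (h u + h (-u)) / 2 := by
      intro u
      have : Real.cosh (a * |u|) = Real.cosh (a * u) := by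
        rcases abs_cases u with ⟨h, _⟩ | ⟨h, _⟩ <;> simp [h]
      rw [Real.cosh_abs, this, hh]
      simp only [Real.cosh_neg]
      rw [Real.cosh_eq (a * u)]
      ring_nf
    simp only [h3]
    rw [integral_div, integral_add hint hint.comp_neg, h2]
    ring
  rw [rho, hR, heven]
  ring

lemma rho_pos (a : ℝ) {x : ℝ} (hx : 0 < x) : 0 < rho a x :=
  rho_eq_rhoInt a hx ▸ rhoInt_pos a hx

lemma contDiffOn_rho (a : ℝ) : ContDiffOn ℝ ∞ (rho a) (Ioi 0) :=
  (contDiffOn_rhoInt a).congr fun _ hx => rho_eq_rhoInt a hx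

lemma hasDerivAt_rho (a : ℝ) {x : ℝ} (hx : 0 < x) :
    HasDerivAt (rho a) (-rho (a - 1) x) x := by
  rw [rho_eq_rhoInt _ hx]
  exact (hasDerivAt_rhoInt a hx).congr_of_eventuallyEq
    (Filter.eventually_of_mem (Ioi_mem_nhds hx) fun y hy => rho_eq_rhoInt a hy)

lemma rho_add_one (a : ℝ) {x : ℝ} (hx : 0 < x) :
    rho (a + 1) x = a * rho a x + x * rho (a - 1) x := by
  simpa only [rho_eq_rhoInt _ hx] using rhoInt_add_one a hx

/-! ### Pochhammer symbols and the terminating `₃F₂` -/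

lemma poch_zero (a : ℝ) : poch a 0 = 1 := by simp [poch]

lemma poch_succ (a : ℝ) (k : ℕ) : poch a (k + 1) = poch a k * (a + k) := by
  simp [poch, ascPochhammer_succ_right]

lemma poch_pos {a : ℝ} (ha : 0 < a) (k : ℕ) : 0 < poch a k := ascPochhammer_pos k a ha

lemma poch_one (k : ℕ) : poch 1 k = k ! := ascPochhammer_eval_one ℝ k

lemma poch_add (a : ℝ) (m n : ℕ) : poch a (m + n) = poch a m * poch (a + m) n := by
  rw [poch, ← ascPochhammer_mul]
  simp [poch]

lemma poch_neg_natCast (n k : ℕ) :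
    poch (-(n : ℝ)) k = (-1) ^ k * ((k ! : ℝ) * (n.choose k : ℝ)) := by
  rw [poch, ascPochhammer_eval_neg_eq_descPochhammer, descPochhammer_eval_eq_descFactorial,
    Nat.descFactorial_eq_factorial_mul_choose, Nat.cast_mul]

/-- The polynomial `(ν - X)_r (-X)_r`. Evaluated at the Euler operator `x d/dx` it acts on `ρ_ν`
as multiplication by `x^r`. -/
def powSymbol (ν : ℝ) (r : ℕ) : ℝ[X] :=
  (ascPochhammer ℝ r).comp (C ν - X) * (ascPochhammer ℝ r).comp (-X)

lemma natDegree_powSymbol_le (ν : ℝ) (r : ℕ) : (powSymbol ν r).natDegree ≤ 2 * r := by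
  refine natDegree_mul_le.trans ?_
  have h1 : (C ν - X : ℝ[X]).natDegree ≤ 1 := by compute_degree
  have h2 : (-X : ℝ[X]).natDegree ≤ 1 := by compute_degree
  have h3 := natDegree_comp_le (p := ascPochhammer ℝ r) (q := C ν - X)
  have h4 := natDegree_comp_le (p := ascPochhammer ℝ r) (q := -X)
  rw [ascPochhammer_natDegree] at h3 h4
  nlinarith

lemma powSymbol_succ (ν : ℝ) (r : ℕ) : powSymbol ν (r + 1) =
    X * (X * powSymbol ν r) - (ν + 2 * r) • (X * powSymbol ν r)
      + (r * (ν + r)) • powSymbol ν r := by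
  simp only [powSymbol, ascPochhammer_succ_right, mul_comp, add_comp, X_comp, natCast_comp,
    smul_eq_C_mul, map_add, map_mul, map_natCast, map_ofNat]
  ring

lemma eval_powSymbol (ν : ℝ) (r j : ℕ) :
    (powSymbol ν r).eval (-1 - (j : ℝ)) = poch (1 + ν + j) r * poch (1 + j) r := by
  simp only [powSymbol, eval_mul, eval_comp, eval_sub, eval_C, eval_X, eval_neg, poch]
  ring_nf

/-- Summing the terminating series: the `₃F₂` is an alternating binomial sum of the values of
`powSymbol`. -/
lemma hyp3F2_eq_sum {ν : ℝ} (hν : -1 < ν) (r k : ℕ) :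
    (r ! : ℝ) * poch (1 + ν) r * hyp3F2 (-(k : ℝ)) (1 + ν + r) (1 + r) (1 + ν) 1 1 =
      ∑ j ∈ Finset.range (k + 1),
        (-1) ^ j * (k.choose j : ℝ) * (powSymbol ν r).eval (-1 - (j : ℝ)) := by
  have h1 : hyp3F2 (-(k : ℝ)) (1 + ν + r) (1 + r) (1 + ν) 1 1 = ∑ j ∈ Finset.range (k + 1),
      poch (-(k : ℝ)) j * poch (1 + ν + r) j * poch (1 + r) j
        / (poch (1 + ν) j * poch 1 j * (j ! : ℝ)) * 1 ^ j := by
    refine tsum_eq_sum fun j hj => ?_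
    have : k < j := by simpa using hj
    rw [poch_neg_natCast, Nat.choose_eq_zero_of_lt this]
    simp
  rw [h1, Finset.mul_sum]
  refine Finset.sum_congr rfl fun j _ => ?_
  have e1 : poch (1 + ν) r * poch (1 + ν + r) j = poch (1 + ν) j * poch (1 + ν + j) r := by
    rw [← poch_add, ← poch_add, add_comm r]
  have e2 : (r ! : ℝ) * poch (1 + r) j = j ! * poch (1 + j) r := by
    rw [← poch_one, ← poch_one, ← poch_add, ← poch_add, add_comm r]
  have p1 : poch (1 + ν) j ≠ 0 := (poch_pos (by linarith) j).ne'
  have p2 : (j ! : ℝ) ≠ 0 := by positivity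
  rw [eval_powSymbol, poch_neg_natCast, poch_one, one_pow, mul_one]
  calc (r ! : ℝ) * poch (1 + ν) r * ((-1) ^ j * (j ! * (k.choose j)) * poch (1 + ν + r) j
        * poch (1 + r) j / (poch (1 + ν) j * j ! * j !))
      = (-1) ^ j * (k.choose j) * ((poch (1 + ν) r * poch (1 + ν + r) j)
        * (r ! * poch (1 + r) j)) * (j ! / (poch (1 + ν) j * j ! * j !)) := by ring
    _ = _ := by rw [e1, e2]; field_simp

/-- Newton's interpolation formula at the nodes `-1, -2, -3, …`. -/
lemma newton_interpolation (Q : ℝ[X]) {d : ℕ} (hQ : Q.natDegree ≤ d) :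
    Q = ∑ k ∈ Finset.range (d + 1), ((1 / (k ! : ℝ)) * ∑ j ∈ Finset.range (k + 1),
      (-1) ^ j * (k.choose j : ℝ) * Q.eval (-1 - (j : ℝ))) •
        (ascPochhammer ℝ k).comp (X + 1) := by
  set W := ∑ k ∈ Finset.range (d + 1), ((1 / (k ! : ℝ)) * ∑ j ∈ Finset.range (k + 1),
      (-1) ^ j * (k.choose j : ℝ) * Q.eval (-1 - (j : ℝ))) •
        (ascPochhammer ℝ k).comp (X + 1) with hW
  have hdeg : W.natDegree ≤ d := by
    refine natDegree_sum_le_of_forall_le _ _ fun k hk => (natDegree_smul_le _ _).trans ?_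
    have h1 := natDegree_comp_le (p := ascPochhammer ℝ k) (q := X + 1)
    have h2 : (X + 1 : ℝ[X]).natDegree ≤ 1 := by compute_degree
    rw [ascPochhammer_natDegree] at h1
    have : k ≤ d := by simpa [Nat.lt_succ_iff] using hk
    nlinarith
  have hinj : Function.Injective fun j : ℕ => (-1 - (j : ℝ)) := fun i j h => by
    simpa using h
  refine eq_of_degree_sub_lt_of_eval_finset_eq
    ((Finset.range (d + 1)).image fun j : ℕ => (-1 - (j : ℝ))) ?_ ?_
  · rw [Finset.card_image_of_injective _ hinj, Finset.card_range]
    refine lt_of_le_of_lt (degree_le_of_natDegree_le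
      ((natDegree_sub_le _ _).trans (max_le hQ hdeg))) ?_
    exact_mod_cast Nat.lt_succ_self d
  · intro x hx
    obtain ⟨N, hN, rfl⟩ := Finset.mem_image.1 hx
    have hN' : N ≤ d := by simpa [Nat.lt_succ_iff] using hN
    have h1 := shift_eq_sum_fwdDiff_iter (1 : ℕ) (fun j : ℕ => Q.eval (-1 - (j : ℝ))) N 0
    simp only [fwdDiff_iter_eq_sum_shift, zero_add, smul_eq_mul, mul_one, nsmul_eq_mul,
      zsmul_eq_mul] at h1
    rw [h1, hW, eval_finsetSum]
    rw [Finset.sum_subset (Finset.range_mono (Nat.succ_le_succ hN')) (fun k _ hk => by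
      rw [Nat.choose_eq_zero_of_lt (by simpa using hk)]; simp)]
    refine Finset.sum_congr rfl fun k _ => ?_
    have e : ((ascPochhammer ℝ k).comp (X + 1)).eval (-1 - (N : ℝ)) = poch (-(N : ℝ)) k := by
      rw [eval_comp, poch]
      congr 1
      simp only [eval_add, eval_X, eval_one]
      ring
    rw [eval_smul, smul_eq_mul, e, poch_neg_natCast]
    have p : (k ! : ℝ) ≠ 0 := by positivity
    have : (1 / (k ! : ℝ) * ∑ j ∈ Finset.range (k + 1),
        (-1) ^ j * (k.choose j : ℝ) * Q.eval (-1 - (j : ℝ))) *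
        ((-1) ^ k * ((k ! : ℝ) * (N.choose k : ℝ))) =
        (N.choose k : ℝ) * ∑ j ∈ Finset.range (k + 1),
          (-1) ^ k * ((-1) ^ j * (k.choose j : ℝ) * Q.eval (-1 - (j : ℝ))) := by
      rw [← Finset.mul_sum]; field_simp
    rw [this]
    congr 1
    refine Finset.sum_congr rfl fun j hj => ?_
    have hjk : j ≤ k := by simpa [Nat.lt_succ_iff] using hj
    have hs : (-1 : ℝ) ^ k * (-1) ^ j = (-1) ^ (k - j) := by
      rw [← pow_add, show k + j = (k - j) + 2 * j by omega, pow_add, pow_mul]; simp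
    push_cast
    rw [← hs]; ring

/-! ### Polynomials in the Euler operator -/

/-- The Euler operator `f ↦ x f'(x)`. -/
def euler (f : ℝ → ℝ) (x : ℝ) : ℝ := x * deriv f x

/-- The value at `x` of the polynomial `p` in the Euler operator, applied to `f`. -/
def eulerEval (f : ℝ → ℝ) (x : ℝ) : ℝ[X] →ₗ[ℝ] ℝ :=
  Polynomial.lsum fun j => (euler^[j] f x) • LinearMap.id

lemma eulerEval_monomial (f : ℝ → ℝ) (x : ℝ) (j : ℕ) (c : ℝ) :
    eulerEval f x (monomial j c) = c * euler^[j] f x := by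
  simp [eulerEval, Polynomial.lsum_apply, mul_comm]

lemma eulerEval_one (f : ℝ → ℝ) (x : ℝ) : eulerEval f x 1 = f x := by
  have := eulerEval_monomial f x 0 1
  simpa using this

lemma contDiffOn_euler_iterate {f : ℝ → ℝ} (hf : ContDiffOn ℝ ∞ f (Ioi 0)) (j : ℕ) :
    ContDiffOn ℝ ∞ (euler^[j] f) (Ioi 0) := by
  induction j with
  | zero => exact hf
  | succ j ih =>
    rw [Function.iterate_succ_apply']
    exact contDiffOn_id.mul (ih.deriv_of_isOpen isOpen_Ioi (by simp))

lemma hasDerivAt_eulerEval {f : ℝ → ℝ} (hf : ContDiffOn ℝ ∞ f (Ioi 0)) (p : ℝ[X])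
    {x : ℝ} (hx : 0 < x) :
    HasDerivAt (fun y => eulerEval f y p) (eulerEval f x (X * p) / x) x := by
  induction p using Polynomial.induction_on' with
  | add p q hp hq =>
    simp only [mul_add, map_add, add_div]
    exact hp.add hq
  | monomial j c =>
    rw [X_mul_monomial]
    simp only [eulerEval_monomial]
    have hd : DifferentiableAt ℝ (euler^[j] f) x :=
      ((contDiffOn_euler_iterate hf j).differentiableOn (by simp)).differentiableAt
        (Ioi_mem_nhds hx)
    refine (hd.hasDerivAt.const_mul c).congr_deriv ?_
    rw [Function.iterate_succ_apply', euler]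
    field_simp

/-- On functions, `(d/dx)^k ∘ x^k = (δ + 1) ⋯ (δ + k)` for the Euler operator `δ`. -/
lemma iteratedDeriv_pow_mul_eulerEval {f : ℝ → ℝ} (hf : ContDiffOn ℝ ∞ f (Ioi 0)) (k : ℕ)
    (p : ℝ[X]) {x : ℝ} (hx : 0 < x) :
    iteratedDeriv k (fun y => y ^ k * eulerEval f y p) x =
      eulerEval f x ((ascPochhammer ℝ k).comp (X + 1) * p) := by
  induction k generalizing p with
  | zero => simp
  | succ k ih =>
    have h : deriv (fun y => y ^ (k + 1) * eulerEval f y p) =ᶠ[nhds x]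
        fun y => y ^ k * eulerEval f y ((X + 1 + (k : ℝ[X])) * p) := by
      refine Filter.eventually_of_mem (Ioi_mem_nhds hx) fun y (hy : 0 < y) => ?_
      have h1 := ((hasDerivAt_pow (k + 1) y).mul (hasDerivAt_eulerEval hf p hy)).deriv
      refine h1.trans ?_
      beta_reduce
      have e : (X + 1 + (k : ℝ[X])) * p = X * p + ((k : ℝ) + 1) • p := by
        rw [smul_eq_C_mul]; simp; ring
      rw [e, map_add, map_smul, smul_eq_mul]
      push_cast
      field_simp
      ring_nf
    rw [iteratedDeriv_succ', h.iteratedDeriv_eq, ih, ← mul_assoc]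
    congr 2
    rw [ascPochhammer_succ_right]
    simp

/-- Multiplication by `x^r` acts on `ρ_ν` as a polynomial in the Euler operator; the step from
`r` to `r + 1` is the differential equation of `ρ_ν`. -/
lemma pow_mul_rho_eq_eulerEval (ν : ℝ) (r : ℕ) {x : ℝ} (hx : 0 < x) :
    x ^ r * rho ν x = eulerEval (rho ν) x (powSymbol ν r) := by
  induction r generalizing x with
  | zero => simp [powSymbol, eulerEval_one]
  | succ r ih =>
    have hf := contDiffOn_rho ν
    -- Both sides of an identity `g = p(δ) ρ_ν` may be hit with `δ`.
    have step : ∀ {g g' : ℝ → ℝ} {p : ℝ[X]}, (∀ y, 0 < y → g y = eulerEval (rho ν) y p) →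
        (∀ y, 0 < y → HasDerivAt g (g' y) y) →
        ∀ y, 0 < y → y * g' y = eulerEval (rho ν) y (X * p) := by
      intro g g' p hg hg' y hy
      have h1 := (hasDerivAt_eulerEval hf p hy).congr_of_eventuallyEq
        (Filter.eventually_of_mem (Ioi_mem_nhds hy) fun z hz => hg z hz)
      rw [(hg' y hy).unique h1]
      field_simp
    have h1 := step (fun y hy => ih hy)
      (fun y hy => (hasDerivAt_pow r y).mul (hasDerivAt_rho ν hy))
    have h1' : ∀ y, 0 < y → r * (y ^ r * rho ν y) - y ^ (r + 1) * rho (ν - 1) y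
        = eulerEval (rho ν) y (X * powSymbol ν r) := by
      intro y hy
      rw [← h1 y hy]
      rcases r with _ | r
      · simp
      · simp only [Nat.add_sub_cancel]; ring
    have h2 := step h1' (fun y hy => (((hasDerivAt_pow r y).mul
      (hasDerivAt_rho ν hy)).const_mul (r : ℝ)).sub ((hasDerivAt_pow (r + 1) y).mul
        (hasDerivAt_rho (ν - 1) hy)))
    have hrec := rho_add_one (ν - 1) hx
    rw [sub_add_cancel] at hrec
    rw [powSymbol_succ, map_add, map_sub, map_smul, map_smul, ← ih hx, ← h1' x hx, ← h2 x hx]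
    simp only [smul_eq_mul, Nat.add_sub_cancel]
    have e : x * (r * (r * x ^ (r - 1) * rho ν x)) = r * (r * (x ^ r * rho ν x)) := by
      rcases r with _ | r
      · simp
      · simp only [Nat.add_sub_cancel]; ring
    push_cast
    linear_combination (-1) * e + x ^ (r + 1) * hrec

/-- The Rodrigues-type formula for `x^r ρ_ν(x)`. -/
lemma pow_mul_rho_eq_rodrigues {ν : ℝ} (hν : -1 < ν) (r : ℕ) {x : ℝ} (hx : 0 < x) :
    x ^ r * rho ν x = (r ! : ℝ) * poch (1 + ν) r * ∑ k ∈ Finset.range (2 * r + 1),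
      1 / (k ! : ℝ) * iteratedDeriv k (fun y : ℝ => y ^ k * rho ν y) x *
        hyp3F2 (-(k : ℝ)) (1 + ν + r) (1 + r) (1 + ν) 1 1 := by
  rw [pow_mul_rho_eq_eulerEval ν r hx, newton_interpolation _ (natDegree_powSymbol_le ν r),
    map_sum, Finset.mul_sum]
  refine Finset.sum_congr rfl fun k _ => ?_
  have h := iteratedDeriv_pow_mul_eulerEval (contDiffOn_rho ν) k 1 hx
  simp only [eulerEval_one, mul_one] at h
  rw [map_smul, smul_eq_mul, h, ← hyp3F2_eq_sum hν]
  ring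

/-! ### Gamma and beta integrals as Lebesgue integrals of nonnegative functions -/

/-- Tonelli computations are carried out with `∫⁻`; this transfers the outcome to the Bochner
integral, with integrability. -/
lemma integrableOn_and_integral_eq_of_lintegral {f : ℝ → ℝ} {c : ℝ}
    (hm : AEStronglyMeasurable f (volume.restrict (Ioi 0))) (h0 : ∀ x, 0 < x → 0 ≤ f x)
    (hc : 0 ≤ c) (h : ∫⁻ x in Ioi 0, ENNReal.ofReal (f x) = ENNReal.ofReal c) :
    IntegrableOn f (Ioi 0) ∧ ∫ x in Ioi 0, f x = c := by
  have h0' : 0 ≤ᵐ[volume.restrict (Ioi 0)] f :=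
    (ae_restrict_mem measurableSet_Ioi).mono fun x hx => h0 x hx
  refine ⟨⟨hm, ?_⟩, ?_⟩
  · rw [hasFiniteIntegral_iff_ofReal h0', h]
    exact ENNReal.ofReal_lt_top
  · rw [integral_eq_lintegral_of_nonneg_ae h0' hm, h, ENNReal.toReal_ofReal hc]

lemma lintegral_rpow_mul_exp {a r : ℝ} (ha : 0 < a) (hr : 0 < r) :
    ∫⁻ t in Ioi (0 : ℝ), ENNReal.ofReal (t ^ (a - 1) * Real.exp (-(r * t))) =
      ENNReal.ofReal ((1 / r) ^ a * Real.Gamma a) := by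
  have h := Real.integral_rpow_mul_exp_neg_mul_Ioi ha hr
  have hpos : 0 < (1 / r) ^ a * Real.Gamma a := mul_pos (by positivity) (Real.Gamma_pos_of_pos ha)
  rw [← h, ofReal_integral_eq_lintegral_ofReal (Integrable.of_integral_ne_zero
    (by rw [h]; exact hpos.ne'))]
  exact (ae_restrict_mem measurableSet_Ioi).mono fun t (ht : 0 < t) => by
    simp only [Pi.zero_apply]; positivity

lemma lintegral_Ioi_congr {f g : ℝ → ENNReal} (h : ∀ x, 0 < x → f x = g x) :
    ∫⁻ x in Ioi (0 : ℝ), f x = ∫⁻ x in Ioi (0 : ℝ), g x :=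
  setLIntegral_congr_fun measurableSet_Ioi fun x hx => h x hx

lemma lintegral_Ioi_ofReal_const_mul {f : ℝ → ℝ} {c : ℝ} (hc : 0 ≤ c) (hf : Measurable f) :
    ∫⁻ x in Ioi (0 : ℝ), ENNReal.ofReal (c * f x) =
      ENNReal.ofReal c * ∫⁻ x in Ioi (0 : ℝ), ENNReal.ofReal (f x) := by
  simp only [ENNReal.ofReal_mul hc]
  exact lintegral_const_mul _ hf.ennreal_ofReal

lemma lintegral_const_mul_rpow_mul_exp {a r c : ℝ} (ha : 0 < a) (hr : 0 < r) (hc : 0 ≤ c) :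
    ∫⁻ t in Ioi (0 : ℝ), ENNReal.ofReal (c * (t ^ (a - 1) * Real.exp (-(r * t)))) =
      ENNReal.ofReal (c * ((1 / r) ^ a * Real.Gamma a)) := by
  rw [lintegral_Ioi_ofReal_const_mul hc (by fun_prop), lintegral_rpow_mul_exp ha hr,
    ENNReal.ofReal_mul hc]

lemma lintegral_Ioi_swap {F : ℝ → ℝ → ℝ} (hF : Measurable (Function.uncurry F)) :
    ∫⁻ x in Ioi (0 : ℝ), ∫⁻ y in Ioi (0 : ℝ), ENNReal.ofReal (F x y) =
      ∫⁻ y in Ioi (0 : ℝ), ∫⁻ x in Ioi (0 : ℝ), ENNReal.ofReal (F x y) :=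
  lintegral_lintegral_swap (Measurable.ennreal_ofReal hF).aemeasurable

lemma lintegral_Ioi_rotate {F : ℝ → ℝ → ℝ → ℝ}
    (hF : Measurable fun z : ℝ × ℝ × ℝ => F z.1 z.2.1 z.2.2) :
    ∫⁻ x in Ioi (0 : ℝ), ∫⁻ s in Ioi (0 : ℝ), ∫⁻ t in Ioi (0 : ℝ), ENNReal.ofReal (F x s t) =
      ∫⁻ s in Ioi (0 : ℝ), ∫⁻ t in Ioi (0 : ℝ), ∫⁻ x in Ioi (0 : ℝ),
        ENNReal.ofReal (F x s t) := by
  rw [lintegral_lintegral_swap]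
  · refine lintegral_congr fun s => ?_
    exact lintegral_Ioi_swap (F := fun x t => F x s t)
      (hF.comp (by fun_prop : Measurable fun z : ℝ × ℝ => (z.1, s, z.2)))
  · have : Measurable fun z : (ℝ × ℝ) × ℝ => ENNReal.ofReal (F z.1.1 z.1.2 z.2) :=
      (hF.comp (by fun_prop : Measurable fun z : (ℝ × ℝ) × ℝ =>
        (z.1.1, z.1.2, z.2))).ennreal_ofReal
    exact this.lintegral_prod_right'.aemeasurable

/-- The beta integral of the second kind. -/
lemma lintegral_beta {c d : ℝ} (hc : 0 < c) (hd : 0 < d) :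
    ∫⁻ w in Ioi (0 : ℝ), ENNReal.ofReal (w ^ (c - 1) * (1 / (1 + w)) ^ (c + d)) =
      ENNReal.ofReal (Real.Gamma c * Real.Gamma d / Real.Gamma (c + d)) := by
  have hcd : 0 < Real.Gamma (c + d) := Real.Gamma_pos_of_pos (by linarith)
  have hgc : 0 < Real.Gamma c := Real.Gamma_pos_of_pos hc
  have key := lintegral_Ioi_swap (F := fun w v : ℝ => (w ^ (c - 1) / Real.Gamma (c + d)) *
    (v ^ (c + d - 1) * Real.exp (-((1 + w) * v)))) (by unfold Function.uncurry; fun_prop)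
  have h1 : ∀ w : ℝ, 0 < w → ∫⁻ v in Ioi (0 : ℝ), ENNReal.ofReal
      ((w ^ (c - 1) / Real.Gamma (c + d)) * (v ^ (c + d - 1) * Real.exp (-((1 + w) * v)))) =
      ENNReal.ofReal (w ^ (c - 1) * (1 / (1 + w)) ^ (c + d)) := by
    intro w hw
    rw [lintegral_const_mul_rpow_mul_exp (by linarith) (by linarith) (by positivity)]
    congr 1
    field_simp
  have h2 : ∀ v : ℝ, 0 < v → ∫⁻ w in Ioi (0 : ℝ), ENNReal.ofReal
      ((w ^ (c - 1) / Real.Gamma (c + d)) * (v ^ (c + d - 1) * Real.exp (-((1 + w) * v)))) =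
      ENNReal.ofReal (Real.Gamma c / Real.Gamma (c + d) *
        (v ^ (d - 1) * Real.exp (-(1 * v)))) := by
    intro v hv
    have e : ∀ w : ℝ, (w ^ (c - 1) / Real.Gamma (c + d)) *
        (v ^ (c + d - 1) * Real.exp (-((1 + w) * v))) =
        (v ^ (c + d - 1) * Real.exp (-(1 * v)) / Real.Gamma (c + d)) *
          (w ^ (c - 1) * Real.exp (-(v * w))) := by
      intro w
      rw [show -((1 + w) * v) = -(1 * v) + -(v * w) by ring, Real.exp_add]
      ring
    simp only [e]
    rw [lintegral_const_mul_rpow_mul_exp hc hv (by positivity)]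
    congr 1
    have e2 : v ^ (c + d - 1) = v ^ c * v ^ (d - 1) := by
      rw [← Real.rpow_add hv]; ring_nf
    rw [e2, Real.div_rpow zero_le_one hv.le, Real.one_rpow]
    field_simp
  rw [lintegral_Ioi_congr h1, lintegral_Ioi_congr h2,
    lintegral_const_mul_rpow_mul_exp hd one_pos (by positivity)] at key
  rw [key]
  congr 1
  simp
  ring

/-! ### Moments of `ρ_a` and of products `ρ_a ρ_b` -/

lemma measurable_rho (a : ℝ) : Measurable (rho a) := by
  have h : Measurable (macdonaldK a) := by
    have : StronglyMeasurable (Function.uncurry fun z u : ℝ =>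
        Real.exp (-z * Real.cosh u) * Real.cosh (a * u)) := by
      have h1 : Continuous (Function.uncurry fun z u : ℝ =>
        Real.exp (-z * Real.cosh u) * Real.cosh (a * u)) := by
        unfold Function.uncurry
        exact (Real.continuous_exp.comp (continuous_fst.neg.mul
          (Real.continuous_cosh.comp continuous_snd))).mul
          (Real.continuous_cosh.comp (continuous_const.mul continuous_snd))
      exact h1.stronglyMeasurable
    exact (this.integral_prod_right (ν := volume.restrict (Ioi 0))).measurable
  unfold rho
  exact Measurable.mul (by fun_prop) (h.comp (by fun_prop))

lemma measurable_rhoKernel_uncurry (a : ℝ) :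
    Measurable (Function.uncurry fun x t : ℝ => rhoKernel a x t) := by
  unfold rhoKernel Function.uncurry; fun_prop

lemma ofReal_rho (a : ℝ) {x : ℝ} (hx : 0 < x) :
    ENNReal.ofReal (rho a x) = ∫⁻ t in Ioi (0 : ℝ), ENNReal.ofReal (rhoKernel a x t) := by
  rw [rho_eq_rhoInt a hx, rhoInt, ofReal_integral_eq_lintegral_ofReal (integrableOn_rhoKernel a hx)]
  exact (ae_restrict_mem measurableSet_Ioi).mono fun t ht => (rhoKernel_pos a x ht).le

lemma ofReal_mul_rho (a : ℝ) {x c : ℝ} (hx : 0 < x) (hc : 0 ≤ c) :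
    ENNReal.ofReal (c * rho a x) =
      ∫⁻ t in Ioi (0 : ℝ), ENNReal.ofReal (c * rhoKernel a x t) := by
  rw [ENNReal.ofReal_mul hc, ofReal_rho a hx,
    lintegral_Ioi_ofReal_const_mul hc (measurable_rhoKernel a x)]

/-- Moments of `ρ_a`. -/
lemma moment_rho {a p : ℝ} (hp : 0 < p) (hap : 0 < a + p) :
    IntegrableOn (fun x => x ^ (p - 1) * rho a x) (Ioi 0) ∧
      ∫ x in Ioi 0, x ^ (p - 1) * rho a x = Real.Gamma p * Real.Gamma (a + p) := by
  have gp := Real.Gamma_pos_of_pos hp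
  have gap := Real.Gamma_pos_of_pos hap
  refine integrableOn_and_integral_eq_of_lintegral
    (Measurable.mul (by fun_prop) (measurable_rho a)).aestronglyMeasurable
    (fun x hx => mul_nonneg (by positivity) (rho_pos a hx).le) (by positivity) ?_
  rw [lintegral_Ioi_congr fun x hx => ofReal_mul_rho a hx (c := x ^ (p - 1)) (by positivity),
    lintegral_Ioi_swap (F := fun x t => x ^ (p - 1) * rhoKernel a x t)
      (Measurable.mul (by fun_prop) (measurable_rhoKernel_uncurry a))]
  have h1 : ∀ t : ℝ, 0 < t →
      ∫⁻ x in Ioi (0 : ℝ), ENNReal.ofReal (x ^ (p - 1) * rhoKernel a x t) =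
      ENNReal.ofReal (Real.Gamma p * (t ^ (a + p - 1) * Real.exp (-(1 * t)))) := by
    intro t ht
    have e : ∀ x : ℝ, x ^ (p - 1) * rhoKernel a x t = (t ^ (a - 1) * Real.exp (-(1 * t))) *
        (x ^ (p - 1) * Real.exp (-(1 / t * x))) := by
      intro x
      rw [rhoKernel, show -t - x / t = -(1 * t) + -(1 / t * x) by ring, Real.exp_add]
      ring
    simp only [e]
    rw [lintegral_const_mul_rpow_mul_exp hp (by positivity) (by positivity)]
    congr 1
    have e2 : t ^ (a + p - 1) = t ^ p * t ^ (a - 1) := by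
      rw [← Real.rpow_add ht]; ring_nf
    rw [one_div_one_div, e2]; ring
  rw [lintegral_Ioi_congr h1, lintegral_const_mul_rpow_mul_exp hap one_pos gp.le]
  simp

/-- Moments of `ρ_a ρ_b`. The factor `Γ(p) (1/s + 1/t)^{-p}` left by the integration over `x` is
written as `(st)^p ∫_0^∞ w^{p-1} e^{-w(s+t)} dw`, which separates the variables `s` and `t`. -/
lemma moment_rho_mul_rho {a b p : ℝ} (hp : 0 < p) (hap : 0 < a + p) (hbp : 0 < b + p)
    (habp : 0 < a + b + p) :
    IntegrableOn (fun x => x ^ (p - 1) * rho a x * rho b x) (Ioi 0) ∧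
      ∫ x in Ioi 0, x ^ (p - 1) * rho a x * rho b x =
        Real.Gamma p * Real.Gamma (a + p) * Real.Gamma (b + p) * Real.Gamma (a + b + p) /
          Real.Gamma (a + b + 2 * p) := by
  have gp := Real.Gamma_pos_of_pos hp
  have gap := Real.Gamma_pos_of_pos hap
  have gbp := Real.Gamma_pos_of_pos hbp
  have gabp := Real.Gamma_pos_of_pos habp
  have gd : 0 < Real.Gamma (a + b + 2 * p) := Real.Gamma_pos_of_pos (by linarith)
  refine integrableOn_and_integral_eq_of_lintegral
    ((Measurable.mul (by fun_prop) (measurable_rho a)).mul (measurable_rho b)).aestronglyMeasurable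
    (fun x hx => mul_nonneg (mul_nonneg (by positivity) (rho_pos a hx).le) (rho_pos b hx).le)
    (by positivity) ?_
  have h1 : ∀ x : ℝ, 0 < x → ENNReal.ofReal (x ^ (p - 1) * rho a x * rho b x) =
      ∫⁻ s in Ioi (0 : ℝ), ∫⁻ t in Ioi (0 : ℝ),
        ENNReal.ofReal (x ^ (p - 1) * rhoKernel a x s * rhoKernel b x t) := by
    intro x hx
    rw [mul_right_comm, ofReal_mul_rho a hx (mul_nonneg (by positivity) (rho_pos b hx).le)]
    refine lintegral_Ioi_congr fun s hs => ?_
    rw [mul_right_comm]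
    exact ofReal_mul_rho b hx (mul_nonneg (by positivity) (rhoKernel_pos a x hs).le)
  have h2 : ∀ s : ℝ, 0 < s → ∀ t : ℝ, 0 < t → ∫⁻ x in Ioi (0 : ℝ),
        ENNReal.ofReal (x ^ (p - 1) * rhoKernel a x s * rhoKernel b x t) =
      ∫⁻ w in Ioi (0 : ℝ), ENNReal.ofReal (w ^ (p - 1) *
        (s ^ (a + p - 1) * Real.exp (-((1 + w) * s))) *
        (t ^ (b + p - 1) * Real.exp (-((1 + w) * t)))) := by
    intro s hs t ht
    have e1 : ∀ x : ℝ, x ^ (p - 1) * rhoKernel a x s * rhoKernel b x t =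
        (s ^ (a - 1) * t ^ (b - 1) * Real.exp (-s) * Real.exp (-t)) *
          (x ^ (p - 1) * Real.exp (-((1 / s + 1 / t) * x))) := by
      intro x
      rw [rhoKernel, rhoKernel, show -s - x / s = -s + -(1 / s * x) by ring,
        show -t - x / t = -t + -(1 / t * x) by ring,
        show -((1 / s + 1 / t) * x) = -(1 / s * x) + -(1 / t * x) by ring,
        Real.exp_add, Real.exp_add, Real.exp_add]
      ring
    have e2 : ∀ w : ℝ, w ^ (p - 1) * (s ^ (a + p - 1) * Real.exp (-((1 + w) * s))) *
        (t ^ (b + p - 1) * Real.exp (-((1 + w) * t))) =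
        (s ^ (a - 1) * t ^ (b - 1) * Real.exp (-s) * Real.exp (-t) * (s * t) ^ p) *
          (w ^ (p - 1) * Real.exp (-((s + t) * w))) := by
      intro w
      rw [show -((1 + w) * s) = -s + -(s * w) by ring, show -((1 + w) * t) = -t + -(t * w) by ring,
        show -((s + t) * w) = -(s * w) + -(t * w) by ring,
        Real.exp_add, Real.exp_add, Real.exp_add, Real.mul_rpow hs.le ht.le,
        show a + p - 1 = a - 1 + p by ring, show b + p - 1 = b - 1 + p by ring,
        Real.rpow_add hs, Real.rpow_add ht]
      ring
    simp only [e1, e2]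
    rw [lintegral_const_mul_rpow_mul_exp hp (by positivity) (by positivity),
      lintegral_const_mul_rpow_mul_exp hp (by positivity) (by positivity)]
    congr 1
    have e3 : (1 / (1 / s + 1 / t)) ^ p = (s * t) ^ p * (1 / (s + t)) ^ p := by
      rw [← Real.mul_rpow (by positivity) (by positivity)]
      congr 1
      field_simp
      ring
    rw [e3]; ring
  have h3 : ∀ w : ℝ, 0 < w → ∫⁻ s in Ioi (0 : ℝ), ∫⁻ t in Ioi (0 : ℝ),
      ENNReal.ofReal (w ^ (p - 1) * (s ^ (a + p - 1) * Real.exp (-((1 + w) * s))) *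
        (t ^ (b + p - 1) * Real.exp (-((1 + w) * t)))) =
      ENNReal.ofReal ((Real.Gamma (a + p) * Real.Gamma (b + p)) *
        (w ^ (p - 1) * (1 / (1 + w)) ^ (p + (a + b + p)))) := by
    intro w hw
    have hw1 : 0 < 1 + w := by linarith
    have e : ∀ s : ℝ, 0 < s → ∫⁻ t in Ioi (0 : ℝ),
        ENNReal.ofReal (w ^ (p - 1) * (s ^ (a + p - 1) * Real.exp (-((1 + w) * s))) *
        (t ^ (b + p - 1) * Real.exp (-((1 + w) * t)))) = ENNReal.ofReal
        ((w ^ (p - 1) * ((1 / (1 + w)) ^ (b + p) * Real.Gamma (b + p))) *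
          (s ^ (a + p - 1) * Real.exp (-((1 + w) * s)))) := by
      intro s hs
      rw [lintegral_const_mul_rpow_mul_exp hbp hw1 (by positivity)]
      congr 1
      ring
    rw [lintegral_Ioi_congr e, lintegral_const_mul_rpow_mul_exp hap hw1 (by positivity)]
    congr 1
    rw [show p + (a + b + p) = (a + p) + (b + p) by ring,
      Real.rpow_add (by positivity) (a + p) (b + p)]
    ring
  rw [lintegral_Ioi_congr h1, lintegral_Ioi_rotate
      (F := fun x s t => x ^ (p - 1) * rhoKernel a x s * rhoKernel b x t)
      (by unfold rhoKernel; fun_prop),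
    lintegral_Ioi_congr fun s hs => lintegral_Ioi_congr fun t ht => h2 s hs t ht,
    ← lintegral_Ioi_rotate (F := fun w s t => w ^ (p - 1) *
        (s ^ (a + p - 1) * Real.exp (-((1 + w) * s))) *
        (t ^ (b + p - 1) * Real.exp (-((1 + w) * t)))) (by fun_prop),
    lintegral_Ioi_congr h3, lintegral_Ioi_ofReal_const_mul (by positivity) (by fun_prop),
    lintegral_beta hp habp, ← ENNReal.ofReal_mul (by positivity)]
  congr 1
  rw [show p + (a + b + p) = a + b + 2 * p by ring]
  ring

/-! ### The functions `θ^k φ` as Laplace-type transforms of `x^k ρ_ν` -/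

/-- The integral `∫_0^∞ x^k ρ_ν(x) e^{-x/t} dx`. -/
def laplaceRho (ν : ℝ) (k : ℕ) (t : ℝ) : ℝ :=
  ∫ x in Ioi (0 : ℝ), x ^ k * rho ν x * Real.exp (-x / t)

lemma integrableOn_pow_mul_rho {ν : ℝ} (hν : -1 < ν) (k : ℕ) :
    IntegrableOn (fun x => x ^ k * rho ν x) (Ioi 0) := by
  have hk : (0 : ℝ) ≤ k := k.cast_nonneg
  have h := (moment_rho (a := ν) (p := k + 1) (by linarith) (by linarith)).1
  simpa only [add_sub_cancel_right, Real.rpow_natCast] using h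

lemma measurable_laplaceRho_integrand (ν : ℝ) (k : ℕ) (t : ℝ) :
    Measurable fun x => x ^ k * rho ν x * Real.exp (-x / t) :=
  (Measurable.mul (by fun_prop) (measurable_rho ν)).mul (by fun_prop)

lemma integrableOn_laplaceRho {ν : ℝ} (hν : -1 < ν) (k : ℕ) {t : ℝ} (ht : 0 < t) :
    IntegrableOn (fun x => x ^ k * rho ν x * Real.exp (-x / t)) (Ioi 0) := by
  refine Integrable.mono' (integrableOn_pow_mul_rho hν k)
    (measurable_laplaceRho_integrand ν k t).aestronglyMeasurable ?_
  refine (ae_restrict_mem measurableSet_Ioi).mono fun x (hx : 0 < x) => ?_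
  have hr := rho_pos ν hx
  rw [Real.norm_of_nonneg (by positivity)]
  refine mul_le_of_le_one_right (by positivity) (Real.exp_le_one_iff.2 ?_)
  rw [neg_div]
  exact neg_nonpos.2 (by positivity)

lemma hasDerivAt_laplaceRho {ν : ℝ} (hν : -1 < ν) (k : ℕ) {t : ℝ} (ht : 0 < t) :
    HasDerivAt (laplaceRho ν k) (laplaceRho ν (k + 1) t / t ^ 2) t := by
  have ht2 : 0 < t / 2 := by linarith
  have key := (hasDerivAt_integral_of_dominated_loc_of_deriv_le
    (μ := volume.restrict (Ioi 0)) (F := fun s x => x ^ k * rho ν x * Real.exp (-x / s))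
    (F' := fun s x => x ^ (k + 1) * rho ν x * Real.exp (-x / s) / s ^ 2)
    (bound := fun x => x ^ (k + 1) * rho ν x / (t / 2) ^ 2) (x₀ := t)
    (s := Ioi (t / 2)) (Ioi_mem_nhds (by linarith))
    (Filter.Eventually.of_forall fun s =>
      (measurable_laplaceRho_integrand ν k s).aestronglyMeasurable)
    (integrableOn_laplaceRho hν k ht)
    ((measurable_laplaceRho_integrand ν (k + 1) t).div_const _).aestronglyMeasurable
    ?_ ((integrableOn_pow_mul_rho hν (k + 1)).div_const _) ?_).2
  · rw [integral_div] at key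
    exact key
  · refine (ae_restrict_mem measurableSet_Ioi).mono fun x (hx : 0 < x) s (hs : t / 2 < s) => ?_
    have hr := rho_pos ν hx
    have hs0 : 0 < s := ht2.trans hs
    rw [Real.norm_of_nonneg (by positivity)]
    refine div_le_div₀ (by positivity) ?_ (by positivity) (by gcongr)
    refine mul_le_of_le_one_right (by positivity) (Real.exp_le_one_iff.2 ?_)
    rw [neg_div]
    exact neg_nonpos.2 (by positivity)
  · refine (ae_restrict_mem measurableSet_Ioi).mono fun x _ s (hs : t / 2 < s) => ?_
    have hs0 : 0 < s := ht2.trans hs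
    have h1 : HasDerivAt (fun s : ℝ => -x / s) (x / s ^ 2) s := by
      refine ((hasDerivAt_const s (-x)).div (hasDerivAt_id s) hs0.ne').congr_deriv ?_
      simp only [id]; ring
    refine (h1.exp.const_mul (x ^ k * rho ν x)).congr_deriv ?_
    ring

lemma measurable_laplaceRho (ν : ℝ) (k : ℕ) : Measurable (laplaceRho ν k) := by
  have : StronglyMeasurable (Function.uncurry fun t x : ℝ =>
      x ^ k * rho ν x * Real.exp (-x / t)) := by
    refine Measurable.stronglyMeasurable ?_
    unfold Function.uncurry
    exact (Measurable.mul (by fun_prop) ((measurable_rho ν).comp measurable_snd)).mul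
      (by fun_prop)
  exact (this.integral_prod_right (ν := volume.restrict (Ioi 0))).measurable

/-- The substitution `u = t (1 + y)` in the incomplete gamma function. -/
lemma phi_eq_integral (ν : ℝ) {t : ℝ} (ht : 0 < t) :
    phi ν t = ∫ y in Ioi (0 : ℝ), Real.exp (-(t * y)) * (1 / (1 + y)) ^ (ν + 1) := by
  have h1 : upperGamma (-ν) t = t * ∫ y in Ioi (0 : ℝ),
      Real.exp (-(t * (y + 1))) * (t * (y + 1)) ^ (-ν - 1) := by
    have e1 := integral_comp_mul_left_Ioi (fun u => Real.exp (-u) * u ^ (-ν - 1)) 1 ht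
    have e2 := (measurePreserving_add_right volume (1 : ℝ)).setIntegral_preimage_emb
      (measurableEmbedding_addRight 1)
      (fun y => Real.exp (-(t * y)) * (t * y) ^ (-ν - 1)) (Ioi 1)
    have e3 : (fun y : ℝ => y + 1) ⁻¹' Ioi 1 = Ioi 0 := by ext; simp
    rw [e3] at e2
    rw [e2, e1, mul_one, smul_eq_mul, upperGamma]
    field_simp
  rw [phi, h1, ← mul_assoc, ← integral_const_mul]
  refine setIntegral_congr_fun measurableSet_Ioi fun y (hy : 0 < y) => ?_
  have hy1 : 0 < y + 1 := by linarith
  have e4 : t ^ ν * t ^ (-ν - 1) * t = 1 := by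
    rw [← Real.rpow_add ht, ← Real.rpow_add_one ht.ne']
    ring_nf
    exact Real.rpow_zero t
  have e5 : Real.exp t * Real.exp (-(t * (y + 1))) = Real.exp (-(t * y)) := by
    rw [← Real.exp_add]; ring_nf
  have e6 : (1 / (1 + y)) ^ (ν + 1) = (y + 1) ^ (-ν - 1) := by
    rw [one_div, Real.inv_rpow (by linarith), ← Real.rpow_neg (by linarith)]
    ring_nf
  rw [Real.mul_rpow ht.le hy1.le, e6, ← e5]
  linear_combination (Real.exp t * Real.exp (-(t * (y + 1))) * (y + 1) ^ (-ν - 1)) * e4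

/-- Both sides equal `∫_0^∞ s^ν e^{-s} / (s + t) ds`. -/
lemma laplaceRho_zero {ν : ℝ} (hν : -1 < ν) {t : ℝ} (ht : 0 < t) :
    laplaceRho ν 0 t = Real.Gamma (1 + ν) * (t * phi ν t) := by
  have hg : 0 < Real.Gamma (1 + ν) := Real.Gamma_pos_of_pos (by linarith)
  rw [phi_eq_integral ν ht, laplaceRho, ← integral_const_mul, ← integral_const_mul]
  have h1 : ∀ x : ℝ, 0 < x → ENNReal.ofReal (x ^ 0 * rho ν x * Real.exp (-x / t)) =
      ∫⁻ s in Ioi (0 : ℝ), ENNReal.ofReal (Real.exp (-x / t) * rhoKernel ν x s) := by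
    intro x hx
    rw [← ofReal_mul_rho ν hx (Real.exp_pos _).le, pow_zero, one_mul, mul_comm]
  have h2 : ∀ s : ℝ, 0 < s →
      ∫⁻ x in Ioi (0 : ℝ), ENNReal.ofReal (Real.exp (-x / t) * rhoKernel ν x s) =
      ∫⁻ y in Ioi (0 : ℝ), ENNReal.ofReal
        ((t * Real.exp (-(t * y))) * (s ^ (1 + ν - 1) * Real.exp (-((1 + y) * s)))) := by
    intro s hs
    have e1 : ∀ x : ℝ, Real.exp (-x / t) * rhoKernel ν x s = (s ^ (ν - 1) * Real.exp (-s)) *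
        (x ^ (1 - 1 : ℝ) * Real.exp (-((1 / t + 1 / s) * x))) := by
      intro x
      rw [rhoKernel, show -s - x / s = -s + -(1 / s * x) by ring,
        show -((1 / t + 1 / s) * x) = -x / t + -(1 / s * x) by ring, Real.exp_add, Real.exp_add,
        sub_self, Real.rpow_zero]
      ring
    have e2 : ∀ y : ℝ, (t * Real.exp (-(t * y))) *
        (s ^ (1 + ν - 1) * Real.exp (-((1 + y) * s))) = (s ^ ν * Real.exp (-s) * t) *
        (y ^ (1 - 1 : ℝ) * Real.exp (-((t + s) * y))) := by
      intro y
      rw [show -((1 + y) * s) = -s + -(s * y) by ring,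
        show -((t + s) * y) = -(t * y) + -(s * y) by ring, Real.exp_add, Real.exp_add,
        sub_self, Real.rpow_zero, add_sub_cancel_left]
      ring
    simp only [e1, e2]
    rw [lintegral_const_mul_rpow_mul_exp one_pos (by positivity) (by positivity),
      lintegral_const_mul_rpow_mul_exp one_pos (by positivity) (by positivity)]
    congr 1
    rw [Real.rpow_one, Real.rpow_one, Real.rpow_sub_one hs.ne']
    field_simp
    ring
  have h3 : ∀ y : ℝ, 0 < y → ∫⁻ s in Ioi (0 : ℝ), ENNReal.ofReal
        ((t * Real.exp (-(t * y))) * (s ^ (1 + ν - 1) * Real.exp (-((1 + y) * s)))) =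
      ENNReal.ofReal (Real.Gamma (1 + ν) * (t *
        (Real.exp (-(t * y)) * (1 / (1 + y)) ^ (ν + 1)))) := by
    intro y hy
    rw [lintegral_const_mul_rpow_mul_exp (by linarith) (by linarith) (by positivity)]
    congr 1
    rw [add_comm ν 1]
    ring
  rw [integral_eq_lintegral_of_nonneg_ae, integral_eq_lintegral_of_nonneg_ae,
    lintegral_Ioi_congr h1,
    lintegral_Ioi_swap (F := fun x s => Real.exp (-x / t) * rhoKernel ν x s)
      (Measurable.mul (by fun_prop) (measurable_rhoKernel_uncurry ν)),
    lintegral_Ioi_congr h2, lintegral_Ioi_swap (F := fun s y => (t * Real.exp (-(t * y))) *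
      (s ^ (1 + ν - 1) * Real.exp (-((1 + y) * s)))) (by unfold Function.uncurry; fun_prop),
    lintegral_Ioi_congr h3]
  · refine (ae_restrict_mem measurableSet_Ioi).mono fun y (hy : 0 < y) => ?_
    simp only [Pi.zero_apply]; positivity
  · exact Measurable.aestronglyMeasurable (by fun_prop)
  · refine (ae_restrict_mem measurableSet_Ioi).mono fun x (hx : 0 < x) => ?_
    have := rho_pos ν hx
    simp only [Pi.zero_apply]; positivity
  · exact (measurable_laplaceRho_integrand ν 0 t).aestronglyMeasurable

/-- The operator `θ` acts on `e^{-x/t} / t` as multiplication by `x`. -/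
lemma theta_iterate_phi {ν : ℝ} (hν : -1 < ν) (k : ℕ) {t : ℝ} (ht : 0 < t) :
    theta^[k] (phi ν) t = laplaceRho ν k t / (Real.Gamma (1 + ν) * t) := by
  have hg : 0 < Real.Gamma (1 + ν) := Real.Gamma_pos_of_pos (by linarith)
  induction k generalizing t with
  | zero =>
    rw [laplaceRho_zero hν ht, Function.iterate_zero, id]
    field_simp
  | succ k ih =>
    rw [Function.iterate_succ_apply', theta]
    have h : HasDerivAt (fun s => s * theta^[k] (phi ν) s)
        (laplaceRho ν (k + 1) t / t ^ 2 / Real.Gamma (1 + ν)) t := by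
      refine ((hasDerivAt_laplaceRho hν k ht).div_const _).congr_of_eventuallyEq ?_
      refine Filter.eventually_of_mem (Ioi_mem_nhds ht) fun s (hs : 0 < s) => ?_
      simp only
      rw [ih hs]
      field_simp
    rw [h.deriv]
    field_simp

/-- The moments of `θ^k φ` against the gamma density are moments of `ρ_ν ρ_{ν+i}`. -/
lemma integral_rpow_mul_theta_phi {ν : ℝ} (hν : -(1 / 2) < ν) (k i : ℕ) :
    IntegrableOn (fun t => t ^ ν * Real.exp (-t) * t ^ i * theta^[k] (phi ν) t) (Ioi 0) ∧
      Real.Gamma (1 + ν) * ∫ t in Ioi 0, t ^ ν * Real.exp (-t) * t ^ i * theta^[k] (phi ν) t =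
        ∫ x in Ioi 0, x ^ k * rho ν x * rho (ν + i) x := by
  have hg : 0 < Real.Gamma (1 + ν) := Real.Gamma_pos_of_pos (by linarith)
  have hk : (0 : ℝ) ≤ k := k.cast_nonneg
  have hi : (0 : ℝ) ≤ i := i.cast_nonneg
  have hint := (moment_rho_mul_rho (a := ν) (b := ν + i) (p := k + 1) (by linarith) (by linarith)
    (by linarith) (by linarith)).1
  simp only [add_sub_cancel_right, Real.rpow_natCast] at hint
  have hnn : ∀ x, 0 < x → 0 ≤ x ^ k * rho ν x * rho (ν + i) x := fun x hx =>
    mul_nonneg (mul_nonneg (by positivity) (rho_pos _ hx).le) (rho_pos _ hx).le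
  have h1 : ∀ t : ℝ, 0 < t →
      ENNReal.ofReal (t ^ (ν + i - 1) * Real.exp (-t) * laplaceRho ν k t) =
      ∫⁻ x in Ioi (0 : ℝ), ENNReal.ofReal (x ^ k * rho ν x * rhoKernel (ν + i) x t) := by
    intro t ht
    rw [laplaceRho, ENNReal.ofReal_mul (by positivity), ofReal_integral_eq_lintegral_ofReal
      (integrableOn_laplaceRho (by linarith) k ht), ← lintegral_Ioi_ofReal_const_mul
      (by positivity) (measurable_laplaceRho_integrand ν k t)]
    · congr 1
      ext x
      congr 1
      rw [rhoKernel, show -t - x / t = -t + -x / t by ring, Real.exp_add]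
      ring
    · refine (ae_restrict_mem measurableSet_Ioi).mono fun x (hx : 0 < x) => ?_
      have := rho_pos ν hx
      simp only [Pi.zero_apply]; positivity
  have h2 : ∀ x : ℝ, 0 < x →
      ∫⁻ t in Ioi (0 : ℝ), ENNReal.ofReal (x ^ k * rho ν x * rhoKernel (ν + i) x t) =
      ENNReal.ofReal (x ^ k * rho ν x * rho (ν + i) x) := fun x hx =>
    (ofReal_mul_rho _ hx (mul_nonneg (by positivity) (rho_pos _ hx).le)).symm
  have hlap : ∀ t, 0 < t → 0 ≤ t ^ (ν + i - 1) * Real.exp (-t) * laplaceRho ν k t := by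
    intro t ht
    refine mul_nonneg (by positivity) (setIntegral_nonneg measurableSet_Ioi fun x hx => ?_)
    exact mul_nonneg (mul_nonneg (pow_nonneg (le_of_lt hx) _) (rho_pos _ hx).le)
      (Real.exp_pos _).le
  have key := integrableOn_and_integral_eq_of_lintegral
    (f := fun t => t ^ (ν + i - 1) * Real.exp (-t) * laplaceRho ν k t)
    (c := ∫ x in Ioi 0, x ^ k * rho ν x * rho (ν + i) x)
    (Measurable.mul (by fun_prop) (measurable_laplaceRho ν k)).aestronglyMeasurable hlap
    (setIntegral_nonneg measurableSet_Ioi hnn) (by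
      rw [lintegral_Ioi_congr h1, lintegral_Ioi_swap
        (F := fun t x => x ^ k * rho ν x * rhoKernel (ν + i) x t), lintegral_Ioi_congr h2,
        ofReal_integral_eq_lintegral_ofReal hint
        ((ae_restrict_mem measurableSet_Ioi).mono fun x hx => hnn x hx)]
      exact (Measurable.mul (by fun_prop) ((measurable_rho ν).comp measurable_snd)).mul
        ((measurable_rhoKernel_uncurry _).comp measurable_swap))
  have h3 : EqOn (fun t => t ^ (ν + i - 1) * Real.exp (-t) * laplaceRho ν k t)
      (fun t => Real.Gamma (1 + ν) *
        (t ^ ν * Real.exp (-t) * t ^ i * theta^[k] (phi ν) t)) (Ioi 0) := by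
    intro t (ht : 0 < t)
    simp only
    rw [theta_iterate_phi (by linarith) k ht, Real.rpow_sub_one ht.ne', Real.rpow_add ht,
      Real.rpow_natCast]
    field_simp
  rw [setIntegral_congr_fun measurableSet_Ioi h3, integral_const_mul,
    integrableOn_congr_fun h3 measurableSet_Ioi] at key
  exact ⟨(integrable_const_mul_iff (IsUnit.mk0 _ hg.ne') _).1 key.1, key.2⟩

/-! ### Integration of polynomials against a weight with moments of all orders -/

/-- `w` has absolutely convergent moments of all orders on `(0, ∞)`. -/
def HasMoments (w : ℝ → ℝ) : Prop := ∀ i : ℕ, IntegrableOn (fun t => w t * t ^ i) (Ioi 0)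

lemma HasMoments.integrableOn {w : ℝ → ℝ} (hw : HasMoments w) (p : ℝ[X]) :
    IntegrableOn (fun t => w t * p.eval t) (Ioi 0) := by
  induction p using Polynomial.induction_on' with
  | add p q hp hq =>
    simp only [eval_add, mul_add]
    exact hp.add hq
  | monomial i c =>
    simp only [eval_monomial, mul_left_comm (_ : ℝ) c]
    exact (hw i).const_mul c

/-- The linear functional `p ↦ ∫_0^∞ w(t) p(t) dt`. -/
def HasMoments.form {w : ℝ → ℝ} (hw : HasMoments w) : ℝ[X] →ₗ[ℝ] ℝ where
  toFun p := ∫ t in Ioi (0 : ℝ), w t * p.eval t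
  map_add' p q := by
    simp only [eval_add, mul_add]
    exact integral_add (hw.integrableOn p) (hw.integrableOn q)
  map_smul' c p := by
    simp only [eval_smul, smul_eq_mul, RingHom.id_apply, mul_left_comm (_ : ℝ) c]
    exact integral_const_mul c _

lemma HasMoments.form_apply {w : ℝ → ℝ} (hw : HasMoments w) (p : ℝ[X]) :
    hw.form p = ∫ t in Ioi (0 : ℝ), w t * p.eval t := rfl

/-! ### Laguerre polynomials -/

/-- The generalized Laguerre polynomial, with its coefficients in the form
`(-1)^i binom(n, i) Γ(ν+n+1) / (n! Γ(ν+i+1))`. -/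
def laguerrePoly (ν : ℝ) (n : ℕ) : ℝ[X] :=
  ∑ i ∈ Finset.range (n + 1), ((-1) ^ i * (n.choose i : ℝ) *
    (Real.Gamma (ν + n + 1) / (n ! * Real.Gamma (ν + i + 1)))) • X ^ i

lemma poch_mul_Gamma {a : ℝ} (ha : 0 < a) (n : ℕ) :
    poch a n * Real.Gamma a = Real.Gamma (a + n) := by
  induction n with
  | zero => simp [poch_zero]
  | succ n ih =>
    have h : a + n ≠ 0 := by positivity
    rw [poch_succ, Nat.cast_succ, ← add_assoc, Real.Gamma_add_one h, ← ih]
    ring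

lemma Gamma_index_pos {ν : ℝ} (hν : -1 < ν) (n : ℕ) : 0 < Real.Gamma (ν + n + 1) :=
  Real.Gamma_pos_of_pos (by have : (0 : ℝ) ≤ n := n.cast_nonneg; linarith)

lemma eval_laguerrePoly {ν : ℝ} (hν : -1 < ν) (n : ℕ) (t : ℝ) :
    (laguerrePoly ν n).eval t = laguerre ν n t := by
  rw [laguerrePoly, laguerre, eval_finsetSum]
  refine Finset.sum_congr rfl fun i hi => ?_
  have hin : i ≤ n := by simpa [Nat.lt_succ_iff] using hi
  have hi0 : (0 : ℝ) ≤ i := i.cast_nonneg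
  have h1 := poch_mul_Gamma (a := ν + i + 1) (by linarith) (n - i)
  rw [Nat.cast_sub hin, show ν + i + 1 + ((n : ℝ) - i) = ν + n + 1 by ring] at h1
  have h2 := Gamma_index_pos hν i
  rw [eval_smul, eval_pow, eval_X, smul_eq_mul, ← h1, Nat.cast_choose ℝ hin, neg_pow t]
  have h3 : (n ! : ℝ) ≠ 0 := by positivity
  field_simp

lemma natDegree_laguerrePoly_le (ν : ℝ) (n : ℕ) : (laguerrePoly ν n).natDegree ≤ n := by
  refine natDegree_sum_le_of_forall_le _ _ fun i hi => (natDegree_smul_le _ _).trans ?_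
  rw [natDegree_X_pow]
  simpa [Nat.lt_succ_iff] using hi

lemma coeff_laguerrePoly_self {ν : ℝ} (hν : -1 < ν) (n : ℕ) :
    (laguerrePoly ν n).coeff n = (-1) ^ n / n ! := by
  have h2 := (Gamma_index_pos hν n).ne'
  rw [laguerrePoly, finsetSum_coeff, Finset.sum_eq_single n]
  · simp only [coeff_smul, coeff_X_pow_self, smul_eq_mul, Nat.choose_self, Nat.cast_one]
    field_simp
  · intro i _ hi
    rw [coeff_smul, coeff_X_pow, if_neg (Ne.symm hi), smul_zero]
  · simp

lemma integral_gamma_moment {ν : ℝ} (hν : -1 < ν) (i : ℕ) :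
    IntegrableOn (fun t => t ^ ν * Real.exp (-t) * t ^ i) (Ioi 0) ∧
      ∫ t in Ioi 0, t ^ ν * Real.exp (-t) * t ^ i = Real.Gamma (ν + i + 1) := by
  have hi0 : (0 : ℝ) ≤ i := i.cast_nonneg
  have h : EqOn (fun t => Real.exp (-t) * t ^ (ν + i + 1 - 1))
      (fun t => t ^ ν * Real.exp (-t) * t ^ i) (Ioi 0) := by
    intro t (ht : 0 < t)
    simp only
    rw [add_sub_cancel_right, Real.rpow_add ht, Real.rpow_natCast]
    ring
  rw [Real.Gamma_eq_integral (by linarith), ← setIntegral_congr_fun measurableSet_Ioi h]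
  exact ⟨(integrableOn_congr_fun h measurableSet_Ioi).1
    (Real.GammaIntegral_convergent (by linarith)), rfl⟩

lemma hasMoments_gamma {ν : ℝ} (hν : -1 < ν) : HasMoments fun t => t ^ ν * Real.exp (-t) :=
  fun i => (integral_gamma_moment hν i).1

/-- The alternating sum is a finite difference of order `r` of a polynomial of degree `s`. -/
lemma sum_alternating_choose_poch (ν : ℝ) {r s : ℕ} (hs : s ≤ r) :
    ∑ i ∈ Finset.range (r + 1), (-1) ^ i * (r.choose i : ℝ) * poch (ν + i + 1) s =
      if s = r then (-1) ^ r * (r ! : ℝ) else 0 := by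
  set Q : ℝ[X] := (ascPochhammer ℝ s).comp (X + C (ν + 1)) with hQ
  have hdeg : Q.natDegree = s := by
    rw [hQ, natDegree_comp, natDegree_X_add_C, mul_one, ascPochhammer_natDegree]
  have hlead : Q.leadingCoeff = 1 :=
    ((monic_ascPochhammer ℝ s).comp_X_add_C _).leadingCoeff
  have h := fwdDiff_iter_eq_sum_shift (1 : ℝ) Q.eval r 0
  have hval : (fwdDiff (1 : ℝ))^[r] Q.eval 0 = if s = r then (r ! : ℝ) else 0 := by
    split_ifs with hsr
    · subst hsr
      have := congrFun (Q.fwdDiff_iter_degree_eq_factorial) 0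
      rw [hdeg, hlead] at this
      simpa using this
    · exact congrFun (Q.fwdDiff_iter_eq_zero_of_degree_lt (by omega)) 0
  rw [hval] at h
  have h2 : ∑ i ∈ Finset.range (r + 1), (-1) ^ i * (r.choose i : ℝ) * poch (ν + i + 1) s =
      (-1) ^ r * (if s = r then (r ! : ℝ) else 0) := by
    rw [h, Finset.mul_sum]
    refine Finset.sum_congr rfl fun i hi => ?_
    have hin : i ≤ r := by simpa [Nat.lt_succ_iff] using hi
    have e1 : Q.eval (0 + i • (1 : ℝ)) = poch (ν + i + 1) s := by
      rw [hQ, eval_comp, poch]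
      congr 1
      simp
      ring
    have e2 : (-1 : ℝ) ^ r * (-1) ^ (r - i) = (-1) ^ i := by
      rw [← pow_add, show r + (r - i) = i + 2 * (r - i) by omega, pow_add, pow_mul]; simp
    rw [e1, zsmul_eq_mul]
    push_cast
    rw [← e2]; ring
  rw [h2]
  split_ifs <;> simp

lemma gammaForm_X_pow_mul_laguerrePoly {ν : ℝ} (hν : -1 < ν) {r s : ℕ} (hs : s ≤ r) :
    (hasMoments_gamma hν).form (X ^ s * laguerrePoly ν r) =
      if s = r then (-1) ^ r * Real.Gamma (ν + r + 1) else 0 := by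
  have hr := (Gamma_index_pos hν r).ne'
  have hfac : (r ! : ℝ) ≠ 0 := by positivity
  have hterm : ∀ i : ℕ, (-1) ^ i * (r.choose i : ℝ) *
      (Real.Gamma (ν + r + 1) / (r ! * Real.Gamma (ν + i + 1))) *
      (hasMoments_gamma hν).form (X ^ s * X ^ i) =
      Real.Gamma (ν + r + 1) / r ! * ((-1) ^ i * (r.choose i : ℝ) * poch (ν + i + 1) s) := by
    intro i
    have hi0 : (0 : ℝ) ≤ i := i.cast_nonneg
    have hi := (Gamma_index_pos hν i).ne'
    have h1 := poch_mul_Gamma (a := ν + i + 1) (by linarith) s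
    rw [HasMoments.form_apply, ← pow_add]
    simp only [eval_pow, eval_X]
    rw [(integral_gamma_moment hν (s + i)).2, Nat.cast_add,
      show ν + ((s : ℝ) + i) + 1 = ν + i + 1 + s by ring, ← h1]
    field_simp
  rw [laguerrePoly, Finset.mul_sum, map_sum]
  simp only [mul_smul_comm, map_smul, smul_eq_mul, hterm]
  rw [← Finset.mul_sum, sum_alternating_choose_poch ν hs]
  split_ifs
  · field_simp
  · simp

/-- Orthogonality of the Laguerre polynomial of degree `r` to lower degrees, together with its
pairing with `X^r`. -/
lemma gammaForm_mul_laguerrePoly {ν : ℝ} (hν : -1 < ν) {r : ℕ} {p : ℝ[X]}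
    (hp : p.natDegree ≤ r) :
    (hasMoments_gamma hν).form (p * laguerrePoly ν r) =
      p.coeff r * ((-1) ^ r * Real.Gamma (ν + r + 1)) := by
  have h : p * laguerrePoly ν r =
      ∑ s ∈ Finset.range (r + 1), p.coeff s • (X ^ s * laguerrePoly ν r) := by
    conv_lhs => rw [as_sum_range_C_mul_X_pow' p (Nat.lt_succ_of_le hp), Finset.sum_mul]
    simp only [← smul_eq_C_mul, smul_mul_assoc]
  rw [h, map_sum]
  simp only [map_smul, smul_eq_mul]
  rw [Finset.sum_eq_single r]
  · rw [gammaForm_X_pow_mul_laguerrePoly hν le_rfl, if_pos rfl]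
  · intro s hs hsr
    rw [gammaForm_X_pow_mul_laguerrePoly hν (by simpa [Nat.lt_succ_iff] using hs), if_neg hsr,
      mul_zero]
  · simp

/-- The Laguerre expansion of a polynomial of degree less than `n`. -/
lemma laguerre_expansion {ν : ℝ} (hν : -1 < ν) (n : ℕ) {p : ℝ[X]} (hp : p.degree < n) :
    p = ∑ r ∈ Finset.range n, ((r ! : ℝ) / Real.Gamma (1 + ν + r) *
      (hasMoments_gamma hν).form (p * laguerrePoly ν r)) • laguerrePoly ν r := by
  induction n generalizing p with
  | zero => simpa using hp
  | succ n ih =>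
    have hg := (Gamma_index_pos hν n).ne'
    have hfac : (n ! : ℝ) ≠ 0 := by positivity
    have hpn : p.natDegree ≤ n := natDegree_le_iff_coeff_eq_zero.2 fun N hN =>
      degree_lt_iff_coeff_zero p (n + 1) |>.1 hp N hN
    have hsq : ((-1 : ℝ) ^ n) * (-1) ^ n = 1 := by rw [← mul_pow]; simp
    set c := (n ! : ℝ) / Real.Gamma (1 + ν + n) *
      (hasMoments_gamma hν).form (p * laguerrePoly ν n) with hc
    have hc' : c = p.coeff n * (-1) ^ n * n ! := by
      rw [hc, gammaForm_mul_laguerrePoly hν hpn, show 1 + ν + (n : ℝ) = ν + n + 1 by ring]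
      field_simp
    have hq : (p - c • laguerrePoly ν n).degree < n := by
      rw [degree_lt_iff_coeff_zero]
      intro m hm
      rcases hm.eq_or_lt with rfl | hlt
      · rw [coeff_sub, coeff_smul, coeff_laguerrePoly_self hν, hc', smul_eq_mul]
        field_simp
        linear_combination (-p.coeff n) * hsq
      · rw [coeff_sub, coeff_smul, coeff_eq_zero_of_natDegree_lt (hpn.trans_lt hlt),
          coeff_eq_zero_of_natDegree_lt ((natDegree_laguerrePoly_le ν n).trans_lt hlt)]
        simp
    have h1 := ih hq
    have h2 : ∀ r ∈ Finset.range n, (hasMoments_gamma hν).form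
        ((p - c • laguerrePoly ν n) * laguerrePoly ν r) =
        (hasMoments_gamma hν).form (p * laguerrePoly ν r) := by
      intro r hr
      have hrn : r < n := Finset.mem_range.1 hr
      have hlt := (natDegree_laguerrePoly_le ν r).trans_lt hrn
      rw [sub_mul, map_sub, smul_mul_assoc, map_smul, mul_comm (laguerrePoly ν n),
        gammaForm_mul_laguerrePoly hν hlt.le, coeff_eq_zero_of_natDegree_lt hlt]
      simp
    rw [Finset.sum_range_succ, ← sub_eq_iff_eq_add, h1]
    exact Finset.sum_congr rfl fun r hr => by rw [h2 r hr]

/-! ### The matrix entries `f_{k,m}` as moments of `ρ_ν²` -/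

/-- The Laguerre combination of the functions `ρ_{ν+m+i}` collapses to a multiple of
`x^m ρ_ν(x)`. -/
lemma pow_mul_rho_eq_sum {ν : ℝ} (hν : -1 < ν) (m : ℕ) {x : ℝ} (hx : 0 < x) :
    x ^ m * rho ν x = ∑ i ∈ Finset.range (m + 1), (-1) ^ (m + i) * (m.choose i : ℝ) *
      (Real.Gamma (ν + m + 1) / Real.Gamma (ν + i + 1)) * rho (ν + m + i) x := by
  induction m with
  | zero => simp [(Real.Gamma_pos_of_pos (show 0 < ν + 1 by linarith)).ne']
  | succ m ih =>
    set b : ℕ → ℕ → ℝ := fun m i => (-1) ^ (m + i) * (m.choose i : ℝ) *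
      (Real.Gamma (ν + m + 1) / Real.Gamma (ν + i + 1)) with hb
    have hm0 : (0 : ℝ) ≤ m := m.cast_nonneg
    have hgm : Real.Gamma (ν + m + 1 + 1) = (ν + m + 1) * Real.Gamma (ν + m + 1) :=
      Real.Gamma_add_one (by linarith)
    have b0 : b (m + 1) 0 = -(b m 0 * (ν + m + 1)) := by
      simp only [hb, Nat.choose_zero_right, Nat.cast_succ, ← add_assoc, hgm, pow_succ, add_zero]
      ring
    have bs : ∀ i, b (m + 1) (i + 1) = b m i - b m (i + 1) * (ν + m + (i + 1 : ℕ) + 1) := by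
      intro i
      have hi0 : (0 : ℝ) ≤ i := i.cast_nonneg
      have hgi : Real.Gamma (ν + i + 1 + 1) = (ν + i + 1) * Real.Gamma (ν + i + 1) :=
        Real.Gamma_add_one (by linarith)
      have hgi0 := (Gamma_index_pos hν i).ne'
      have hi1 : ν + i + 1 ≠ 0 := by linarith
      have hch : (m.choose (i + 1) : ℝ) * (i + 1) = m.choose i * ((m : ℝ) - i) := by
        rcases le_or_gt i m with him | him
        · rw [← Nat.cast_sub him]
          exact_mod_cast Nat.choose_succ_right_eq m i
        · rw [Nat.choose_eq_zero_of_lt him, Nat.choose_eq_zero_of_lt (by omega)]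
          simp
      simp only [hb, Nat.choose_succ_succ', Nat.cast_succ, Nat.cast_add, ← add_assoc, hgm, hgi,
        pow_succ]
      field_simp
      linear_combination (-(Real.Gamma (ν + m + 1) * (-1) ^ m * (-1) ^ i)) * hch
    have hstep : ∀ i : ℕ, x * rho (ν + m + i) x =
        rho (ν + (m + 1 : ℕ) + (i + 1 : ℕ)) x
          - (ν + m + i + 1) * rho (ν + (m + 1 : ℕ) + i) x := by
      intro i
      have h := rho_add_one (ν + m + i + 1) hx
      rw [add_sub_cancel_right] at h
      push_cast
      rw [show ν + (m + 1) + (i + 1) = ν + m + i + 1 + 1 by ring,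
        show ν + (m + 1) + i = ν + m + i + 1 by ring, h]
      ring
    have hlast : b m (m + 1) = 0 := by simp [hb]
    change _ = ∑ i ∈ Finset.range (m + 1 + 1), b (m + 1) i * rho (ν + (m + 1 : ℕ) + i) x
    rw [Finset.sum_range_succ']
    simp only [bs, b0, sub_mul, Finset.sum_sub_distrib]
    have e := Finset.sum_range_succ' (fun i : ℕ => b m i * (ν + m + i + 1) *
      rho (ν + (m + 1 : ℕ) + i) x) (m + 1)
    rw [Finset.sum_range_succ, hlast] at e
    rw [pow_succ', mul_assoc, ih, Finset.mul_sum]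
    have e2 : ∀ i : ℕ, x * (b m i * rho (ν + m + i) x) =
        b m i * rho (ν + (m + 1 : ℕ) + (i + 1 : ℕ)) x -
          b m i * (ν + m + i + 1) * rho (ν + (m + 1 : ℕ) + i) x := by
      intro i
      linear_combination b m i * hstep i
    change ∑ i ∈ Finset.range (m + 1), x * (b m i * rho (ν + m + i) x) = _
    simp only [e2, Finset.sum_sub_distrib]
    simp only [Nat.cast_zero, add_zero, zero_mul] at e ⊢
    linear_combination (-1) * e

/-- The moment `∫_0^∞ x^j ρ_ν(x)^2 dx`. -/
def rhoSqMoment (ν : ℝ) (j : ℕ) : ℝ := ∫ x in Ioi (0 : ℝ), rho ν x ^ 2 * x ^ j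

lemma hasMoments_theta_phi {ν : ℝ} (hν : -(1 / 2) < ν) (k : ℕ) :
    HasMoments fun t => t ^ ν * Real.exp (-t) * theta^[k] (phi ν) t := fun i =>
  (integral_rpow_mul_theta_phi hν k i).1.congr_fun
    (fun _ _ => mul_right_comm _ _ _) measurableSet_Ioi

/-- The sum defining `f_{k,m}` is the Laguerre expansion of `t^m L_m^ν(t)`, integrated termwise
against `t^ν e^{-t} θ^k φ(t)`. -/
lemma coefF_eq_form {ν : ℝ} (hν : -(1 / 2) < ν) (k m : ℕ) :
    coefF ν k m = (hasMoments_theta_phi hν k).form (X ^ m * laguerrePoly ν m) := by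
  have hν1 : -1 < ν := by linarith
  have hdeg : (X ^ m * laguerrePoly ν m : ℝ[X]).degree < (2 * m + 1 : ℕ) := by
    refine lt_of_le_of_lt (degree_le_of_natDegree_le (n := 2 * m) ?_)
      (by exact_mod_cast Nat.lt_succ_self _)
    refine natDegree_mul_le.trans ?_
    have := natDegree_laguerrePoly_le ν m
    rw [natDegree_X_pow]
    omega
  conv_rhs => rw [laguerre_expansion hν1 (2 * m + 1) hdeg]
  rw [map_sum, coefF]
  refine Finset.sum_congr rfl fun r _ => ?_
  have hD : coefD ν m r =
      (hasMoments_gamma hν1).form (X ^ m * laguerrePoly ν m * laguerrePoly ν r) := by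
    rw [coefD, HasMoments.form_apply]
    refine setIntegral_congr_fun measurableSet_Ioi fun t (ht : 0 < t) => ?_
    simp only [eval_mul, eval_pow, eval_X, eval_laguerrePoly hν1]
    rw [Real.rpow_add ht, Real.rpow_natCast]
    ring
  have hC : coefC ν k r = (r ! : ℝ) / Real.Gamma (1 + ν + r) *
      (hasMoments_theta_phi hν k).form (laguerrePoly ν r) := by
    rw [coefC, HasMoments.form_apply]
    congr 1
    refine setIntegral_congr_fun measurableSet_Ioi fun t _ => ?_
    simp only [eval_laguerrePoly hν1]
    ring
  rw [hD, hC, map_smul, smul_eq_mul]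
  ring

/-- Apart from a factor depending on the row `m` only, `f_{k,m}` is the Hankel entry
`∫_0^∞ x^{k+m} ρ_ν(x)^2 dx`. -/
lemma Gamma_mul_coefF {ν : ℝ} (hν : -(1 / 2) < ν) (k m : ℕ) :
    Real.Gamma (1 + ν) * coefF ν k m = (-1) ^ m / m ! * rhoSqMoment ν (k + m) := by
  have hν1 : -1 < ν := by linarith
  have hk : (0 : ℝ) ≤ k := k.cast_nonneg
  have hm : (0 : ℝ) ≤ m := m.cast_nonneg
  have hform : ∀ i : ℕ, Real.Gamma (1 + ν) * (hasMoments_theta_phi hν k).form (X ^ m * X ^ i) =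
      ∫ x in Ioi 0, x ^ k * rho ν x * rho (ν + m + i) x := by
    intro i
    have h := (integral_rpow_mul_theta_phi hν k (m + i)).2
    rw [Nat.cast_add, ← add_assoc] at h
    rw [← h, HasMoments.form_apply, ← pow_add]
    congr 1
    refine setIntegral_congr_fun measurableSet_Ioi fun t _ => ?_
    simp only [eval_pow, eval_X]
    ring
  have hint : ∀ i : ℕ, IntegrableOn (fun x => x ^ k * rho ν x * rho (ν + m + i) x) (Ioi 0) := by
    intro i
    have hi : (0 : ℝ) ≤ i := i.cast_nonneg
    have h := (moment_rho_mul_rho (a := ν) (b := ν + m + i) (p := k + 1) (by linarith)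
      (by linarith) (by linarith) (by linarith)).1
    simpa only [add_sub_cancel_right, Real.rpow_natCast] using h
  rw [coefF_eq_form hν, laguerrePoly, Finset.mul_sum, map_sum, Finset.mul_sum]
  simp only [mul_smul_comm, map_smul, smul_eq_mul]
  simp only [mul_left_comm (Real.Gamma (1 + ν)), hform]
  simp only [← integral_const_mul]
  rw [← integral_finsetSum _ fun i _ => (hint i).const_mul _, rhoSqMoment, ← integral_const_mul]
  refine setIntegral_congr_fun measurableSet_Ioi fun x (hx : 0 < x) => ?_
  have hfac : (m ! : ℝ) ≠ 0 := by positivity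
  have hsq : ((-1 : ℝ) ^ m) * (-1) ^ m = 1 := by rw [← mul_pow]; simp
  have e : (-1) ^ m / m ! * (rho ν x ^ 2 * x ^ (k + m)) =
      (-1) ^ m / m ! * (x ^ k * rho ν x) * (x ^ m * rho ν x) := by ring
  rw [e, pow_mul_rho_eq_sum hν1 m hx, Finset.mul_sum]
  refine Finset.sum_congr rfl fun i _ => ?_
  have hgi := (Gamma_index_pos hν1 i).ne'
  rw [pow_add]
  field_simp
  linear_combination (-((m.choose i : ℝ) * Real.Gamma (ν + m + 1) * rho ν x *
    rho (ν + m + i) x)) * hsq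

/-! ### The moment functional of `ρ_ν²` -/

lemma hasMoments_rho_sq {ν : ℝ} (hν : -(1 / 2) < ν) : HasMoments fun x => rho ν x ^ 2 := by
  intro i
  have hi : (0 : ℝ) ≤ i := i.cast_nonneg
  have h := (moment_rho_mul_rho (a := ν) (b := ν) (p := i + 1) (by linarith) (by linarith)
    (by linarith) (by linarith)).1
  simp only [add_sub_cancel_right, Real.rpow_natCast] at h
  exact h.congr_fun (fun _ _ => by ring) measurableSet_Ioi

lemma rhoSqForm_X_pow {ν : ℝ} (hν : -(1 / 2) < ν) (j : ℕ) :
    (hasMoments_rho_sq hν).form (X ^ j) = rhoSqMoment ν j := by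
  simp [HasMoments.form_apply, rhoSqMoment]

lemma rhoSqForm_X_pow_mul {ν : ℝ} (hν : -(1 / 2) < ν) (m : ℕ) {n : ℕ} {p : ℝ[X]}
    (hp : p.natDegree ≤ n) : (hasMoments_rho_sq hν).form (X ^ m * p) =
      ∑ k ∈ Finset.range (n + 1), p.coeff k * rhoSqMoment ν (k + m) := by
  conv_lhs => rw [as_sum_range_C_mul_X_pow' p (Nat.lt_succ_of_le hp), Finset.mul_sum, map_sum]
  refine Finset.sum_congr rfl fun k _ => ?_
  rw [← smul_eq_C_mul, mul_smul_comm, map_smul, smul_eq_mul, ← pow_add, add_comm m,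
    rhoSqForm_X_pow hν]

lemma rhoSqForm_pos {ν : ℝ} (hν : -(1 / 2) < ν) {p : ℝ[X]} (hp : p ≠ 0)
    (h : ∀ x, 0 < x → 0 ≤ p.eval x) : 0 < (hasMoments_rho_sq hν).form p := by
  rw [HasMoments.form_apply, setIntegral_pos_iff_support_of_nonneg_ae _
    ((hasMoments_rho_sq hν).integrableOn p)]
  · have hsub : Ioi (0 : ℝ) \ (p.roots.toFinset : Set ℝ) ⊆
        Function.support (fun x => rho ν x ^ 2 * p.eval x) ∩ Ioi 0 := by
      rintro x ⟨hx, hroot⟩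
      refine ⟨mul_ne_zero (pow_ne_zero 2 (rho_pos ν hx).ne') fun h0 => hroot ?_, hx⟩
      simpa [hp] using h0
    refine lt_of_lt_of_le ?_ (measure_mono hsub)
    rw [measure_sdiff_null ((Finset.finite_toSet _).measure_zero volume)]
    simp
  · exact (ae_restrict_mem measurableSet_Ioi).mono fun x hx => mul_nonneg (sq_nonneg _) (h x hx)

lemma rhoSqMoment_eq {ν : ℝ} (hν : -(1 / 2) < ν) (j : ℕ) : rhoSqMoment ν j =
    √Real.pi * (Real.Gamma (1 + 2 * ν) * Real.Gamma (1 + ν)) /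
      ((2 : ℝ) ^ (1 + 2 * ν) * Real.Gamma (ν + 3 / 2)) *
        ((j ! : ℝ) * (poch (1 + 2 * ν) j * poch (1 + ν) j) /
          ((4 : ℝ) ^ j * poch (ν + 3 / 2) j)) := by
  have hj : (0 : ℝ) ≤ j := j.cast_nonneg
  have h := (moment_rho_mul_rho (a := ν) (b := ν) (p := j + 1) (by linarith) (by linarith)
    (by linarith) (by linarith)).2
  simp only [add_sub_cancel_right, Real.rpow_natCast] at h
  have h1 : rhoSqMoment ν j = ∫ x in Ioi 0, x ^ j * rho ν x * rho ν x :=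
    setIntegral_congr_fun measurableSet_Ioi fun x _ => by ring
  have g1 := poch_mul_Gamma (a := 1 + 2 * ν) (by linarith) j
  have g2 := poch_mul_Gamma (a := 1 + ν) (by linarith) j
  have g3 := poch_mul_Gamma (a := ν + 3 / 2) (by linarith) j
  have hdup := Real.Gamma_mul_Gamma_add_half (1 + ν + j)
  have p3 : 0 < Real.Gamma (ν + 3 / 2) := Real.Gamma_pos_of_pos (by linarith)
  have p4 : 0 < poch (ν + 3 / 2) j := poch_pos (by linarith) j
  have p5 : 0 < Real.Gamma (2 * (1 + ν + j)) := Real.Gamma_pos_of_pos (by linarith)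
  have p6 : 0 < Real.Gamma (1 + ν + j) := Real.Gamma_pos_of_pos (by linarith)
  rw [show 1 + ν + (j : ℝ) + 1 / 2 = ν + 3 / 2 + j by ring, ← g3] at hdup
  have e2 : (2 : ℝ) ^ (1 - 2 * (1 + ν + j)) = ((2 : ℝ) ^ (1 + 2 * ν) * 4 ^ j)⁻¹ := by
    rw [show 1 - 2 * (1 + ν + (j : ℝ)) = -((1 + 2 * ν) + 2 * (j : ℝ)) by ring,
      Real.rpow_neg zero_le_two, Real.rpow_add two_pos, Real.rpow_mul zero_le_two]
    norm_num
  rw [e2] at hdup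
  rw [h1, h, Real.Gamma_nat_eq_factorial, show ν + ((j : ℝ) + 1) = 1 + ν + j by ring,
    show ν + ν + ((j : ℝ) + 1) = 1 + 2 * ν + j by ring,
    show ν + ν + 2 * ((j : ℝ) + 1) = 2 * (1 + ν + j) by ring, ← g1]
  have p7 : (0 : ℝ) < 2 ^ (1 + 2 * ν) := by positivity
  rw [← g2] at hdup p6 ⊢
  generalize Real.Gamma (ν + 3 / 2) = G₁ at *
  generalize Real.Gamma (2 * (1 + ν + j)) = G₂ at *
  generalize Real.Gamma (1 + 2 * ν) = G₃ at *
  generalize Real.Gamma (1 + ν) = G₄ at *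
  generalize poch (ν + 3 / 2) j = q₁ at *
  generalize poch (1 + 2 * ν) j = q₂ at *
  generalize poch (1 + ν) j = q₃ at *
  generalize (2 : ℝ) ^ (1 + 2 * ν) = B at *
  field_simp at hdup ⊢
  linear_combination (q₃ * G₄ * q₂ * G₃) * hdup

lemma normS_eq {ν : ℝ} (hν : -(1 / 2) < ν) (n : ℕ) :
    normS ν n = ∑ k ∈ Finset.range (n + 1), detDk ν n k * rhoSqMoment ν (k + n) := by
  rw [normS, Finset.mul_sum]
  refine Finset.sum_congr rfl fun k _ => ?_
  rw [rhoSqMoment_eq hν, add_comm k n]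
  ring

/-! ### The determinants -/

/-- Linear relations among the `f_{k,m}` are linear relations among moments of `ρ_ν²`. -/
lemma sum_coefF_eq_zero_iff {ν : ℝ} (hν : -(1 / 2) < ν) {ι : Type*} (s : Finset ι) (a : ι → ℝ)
    (κ : ι → ℕ) (m : ℕ) : ∑ k ∈ s, a k * coefF ν (κ k) m = 0 ↔
      ∑ k ∈ s, a k * rhoSqMoment ν (κ k + m) = 0 := by
  have hg : Real.Gamma (1 + ν) ≠ 0 := (Real.Gamma_pos_of_pos (by linarith)).ne'
  have hc : ((-1) ^ m / m ! : ℝ) ≠ 0 := div_ne_zero (pow_ne_zero _ (by norm_num)) (by positivity)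
  have h : Real.Gamma (1 + ν) * ∑ k ∈ s, a k * coefF ν (κ k) m =
      ((-1) ^ m / m !) * ∑ k ∈ s, a k * rhoSqMoment ν (κ k + m) := by
    simp only [Finset.mul_sum, mul_left_comm _ (a _), Gamma_mul_coefF hν]
  rw [← mul_eq_zero_iff_left hg, h, mul_eq_zero_iff_left hc]

/-- A null vector of the matrix is the coefficient vector of a polynomial `q` with
`∫ x q(x)^2 ρ_ν(x)^2 dx = 0`. -/
lemma detD_ne_zero {ν : ℝ} (hν : -(1 / 2) < ν) (n : ℕ) : detD ν n ≠ 0 := by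
  intro h0
  obtain ⟨v, hv, hAv⟩ := Matrix.exists_mulVec_eq_zero_iff.2 h0
  set q : ℝ[X] := ∑ j : Fin n, v j • X ^ (j : ℕ) with hq
  have hcoeff : ∀ j : Fin n, q.coeff j = v j := by
    intro j
    rw [hq, finsetSum_coeff, Finset.sum_eq_single j]
    · simp
    · intro i _ hij
      rw [coeff_smul, coeff_X_pow, if_neg (fun h => hij (Fin.ext h.symm)), smul_zero]
    · simp
  have hq0 : q ≠ 0 := fun h => hv (funext fun j => by rw [← hcoeff j, h]; simp)
  have horth : ∀ i : Fin n, (hasMoments_rho_sq hν).form (X * q * X ^ (i : ℕ)) = 0 := by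
    intro i
    have h1 : ∑ j : Fin n, v j * coefF ν (j + 1) i = 0 := by
      have := congrFun hAv i
      simpa [Matrix.mulVec, dotProduct, mul_comm] using this
    rw [sum_coefF_eq_zero_iff hν Finset.univ v (fun j => (j : ℕ) + 1) i] at h1
    rw [← h1, hq, Finset.mul_sum, Finset.sum_mul, map_sum]
    refine Finset.sum_congr rfl fun j _ => ?_
    rw [mul_smul_comm, smul_mul_assoc, map_smul, smul_eq_mul, ← pow_succ', ← pow_add,
      rhoSqForm_X_pow hν]
  have hzero : (hasMoments_rho_sq hν).form (X * q * q) = 0 := by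
    conv_lhs => rw [show X * q * q = ∑ i : Fin n, v i • (X * q * X ^ (i : ℕ)) by
      simp only [← mul_smul_comm, ← Finset.mul_sum]; rw [← hq]]
    rw [map_sum]
    simp only [map_smul, horth, smul_zero, Finset.sum_const_zero]
  refine (rhoSqForm_pos hν (p := X * q * q) (by simp [hq0]) fun x hx => ?_).ne' hzero
  simp only [eval_mul, eval_X, mul_assoc]
  exact mul_nonneg hx.le (mul_self_nonneg _)

/-- Cramer's rule for the coefficients of a polynomial orthogonal to `1, x, …, x^{n-1}`. -/
lemma detD_mul_coeff {ν : ℝ} (hν : -(1 / 2) < ν) {n : ℕ} {p : ℝ[X]} (hp : p.natDegree ≤ n)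
    (horth : ∀ m < n, (hasMoments_rho_sq hν).form (X ^ m * p) = 0) {k : ℕ} (hk : k ≤ n) :
    detD ν n * p.coeff k = -(p.coeff 0 * detDk ν n k) := by
  rcases k with _ | k
  · simp [detDk]; ring
  · set A : Matrix (Fin n) (Fin n) ℝ := Matrix.of fun i j : Fin n => coefF ν (j + 1) i with hA
    set b : Fin n → ℝ := fun i => coefF ν 0 i with hb
    have hsys : A.mulVec (fun j : Fin n => p.coeff (j + 1)) = -(p.coeff 0) • b := by
      ext i
      have h1 := horth i i.2
      rw [rhoSqForm_X_pow_mul hν _ hp, ← sum_coefF_eq_zero_iff hν _ p.coeff (fun k => k),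
        Finset.sum_range_succ', ← Fin.sum_univ_eq_sum_range (fun j => p.coeff (j + 1) *
          coefF ν (j + 1) i)] at h1
      simp only [Matrix.mulVec, dotProduct, hA, hb, Matrix.of_apply, Pi.smul_apply, smul_eq_mul,
        mul_comm (coefF _ _ _)]
      linarith
    have h2 := congrArg A.adjugate.mulVec hsys
    rw [Matrix.mulVec_mulVec, Matrix.adjugate_mul, Matrix.smul_mulVec, Matrix.one_mulVec,
      Matrix.mulVec_smul, ← Matrix.cramer_eq_adjugate_mulVec] at h2
    have h3 := congrFun h2 ⟨k, hk⟩
    have hdet : A.cramer b ⟨k, hk⟩ = detDk ν n (k + 1) := by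
      rw [Matrix.cramer_apply, detDk, if_neg (Nat.succ_ne_zero k)]
      congr 1
      ext i j
      by_cases hj : (j : ℕ) = k
      · have : j = ⟨k, hk⟩ := Fin.ext hj
        subst this
        simp [hb]
      · rw [Matrix.updateCol_ne (fun h => hj (congrArg Fin.val h))]
        simp [hA, hj]
    simp only [Pi.smul_apply, smul_eq_mul, hdet] at h3
    rw [detD, ← hA, h3]
    ring

lemma IsOrthonormalSeq.form_mul {ν : ℝ} (hν : -(1 / 2) < ν) {P : ℕ → ℝ[X]}
    (hP : IsOrthonormalSeq ν P) (m n : ℕ) :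
    (hasMoments_rho_sq hν).form (P m * P n) = if m = n then 1 else 0 := by
  rw [← hP.orthonormal m n, HasMoments.form_apply]
  refine setIntegral_congr_fun measurableSet_Ioi fun x _ => ?_
  simp only [eval_mul]
  ring

lemma IsOrthonormalSeq.form_mul_eq_zero {ν : ℝ} (hν : -(1 / 2) < ν) {P : ℕ → ℝ[X]}
    (hP : IsOrthonormalSeq ν P) {n d : ℕ} (hd : d ≤ n) {q : ℝ[X]} (hq : q.degree < d) :
    (hasMoments_rho_sq hν).form (q * P n) = 0 := by
  induction d generalizing q with
  | zero =>
    have : q = 0 := by simpa using hq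
    simp [this]
  | succ d ih =>
    have hnd : (P d).natDegree = d := natDegree_eq_of_degree_eq_some (hP.degree_eq d)
    have hlead : (P d).coeff d ≠ 0 := by
      have h0 : P d ≠ 0 := degree_ne_bot.1 (by rw [hP.degree_eq d]; simp)
      simpa [leadingCoeff, hnd] using leadingCoeff_ne_zero.2 h0
    set c := q.coeff d / (P d).coeff d with hc
    have hlt : (q - c • P d).degree < d := by
      rw [degree_lt_iff_coeff_zero]
      intro m hm
      rcases hm.eq_or_lt with rfl | hlt
      · rw [coeff_sub, coeff_smul, hc, smul_eq_mul, div_mul_cancel₀ _ hlead, sub_self]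
      · rw [coeff_sub, coeff_smul, (degree_lt_iff_coeff_zero q (d + 1)).1 hq m hlt,
          coeff_eq_zero_of_natDegree_lt (hnd.trans_lt hlt)]
        simp
    have h1 := ih (by omega) hlt
    rw [sub_mul, map_sub, smul_mul_assoc, map_smul, hP.form_mul hν, if_neg (by omega), smul_zero,
      sub_zero] at h1
    exact h1

end MacdonaldSq

end

open MacdonaldSq in
theorem theorem3 (ν : ℝ) (hν : -(1 / 2 : ℝ) < ν) (P : ℕ → Polynomial ℝ)
    (hP : MacdonaldSq.IsOrthonormalSeq ν P) (n : ℕ) :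
    ContDiffOn ℝ ∞ (MacdonaldSq.rho ν) (Set.Ioi 0) ∧
    (∀ x : ℝ, 0 < x → 0 < MacdonaldSq.rho ν x) ∧
    MacdonaldSq.detD ν n ≠ 0 ∧
    0 < MacdonaldSq.detDk ν n n * MacdonaldSq.normS ν n ∧
    ∃ σ : ℝ, (σ = 1 ∨ σ = -1) ∧
      (0 < (P n).leadingCoeff ↔ σ * MacdonaldSq.detDk ν n n < 0) ∧
      (P n).coeff 0 = MacdonaldSq.freeCoeff ν n σ ∧
      ∀ x : ℝ, 0 < x →
        (P n).eval x =
          -(MacdonaldSq.freeCoeff ν n σ / (MacdonaldSq.detD ν n * MacdonaldSq.rho ν x)) *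
            ∑ r ∈ Finset.range (n + 1),
              MacdonaldSq.detDk ν n r * (r ! : ℝ) * MacdonaldSq.poch (1 + ν) r *
                ∑ k ∈ Finset.range (2 * r + 1),
                  1 / (k ! : ℝ) *
                    iteratedDeriv k (fun y : ℝ => y ^ k * MacdonaldSq.rho ν y) x *
                    MacdonaldSq.hyp3F2 (-(k : ℝ)) (1 + ν + r) (1 + r) (1 + ν) 1 1 := by
  have hD := detD_ne_zero hν n
  have hdeg : (P n).natDegree = n := natDegree_eq_of_degree_eq_some (hP.degree_eq n)
  have horth : ∀ m < n, (hasMoments_rho_sq hν).form (X ^ m * P n) = 0 := fun m hm =>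
    hP.form_mul_eq_zero hν (d := m + 1) hm (by rw [degree_X_pow]; exact_mod_cast Nat.lt_succ_self m)
  have hcoeff : ∀ k ≤ n, detD ν n * (P n).coeff k = -((P n).coeff 0 * detDk ν n k) :=
    fun k hk => detD_mul_coeff hν hdeg.le horth hk
  -- Normalization: `1 = ⟨P_n, P_n⟩ = a_{n,n} ⟨x^n, P_n⟩`.
  have hnorm : (P n).coeff n * ∑ k ∈ Finset.range (n + 1), (P n).coeff k * rhoSqMoment ν (k + n)
      = 1 := by
    have h1 := hP.form_mul hν n n
    have hlt : (P n - (P n).coeff n • X ^ n).degree < (n : WithBot ℕ) := by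
      rw [degree_lt_iff_coeff_zero]
      intro m hm
      rcases hm.eq_or_lt with rfl | hlt
      · simp
      · rw [coeff_sub, coeff_smul, coeff_eq_zero_of_natDegree_lt (hdeg.trans_lt hlt),
          coeff_X_pow, if_neg hlt.ne']
        simp
    have h2 := hP.form_mul_eq_zero hν le_rfl hlt
    rw [sub_mul, map_sub, smul_mul_assoc, map_smul, h1, if_pos rfl,
      rhoSqForm_X_pow_mul hν n hdeg.le, smul_eq_mul] at h2
    linarith
  have hsq : (P n).coeff 0 ^ 2 * (detDk ν n n * normS ν n) = detD ν n ^ 2 := by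
    have h1 : detD ν n * ∑ k ∈ Finset.range (n + 1), (P n).coeff k * rhoSqMoment ν (k + n) =
        -((P n).coeff 0 * normS ν n) := by
      rw [normS_eq hν, Finset.mul_sum, Finset.mul_sum, ← Finset.sum_neg_distrib]
      refine Finset.sum_congr rfl fun k hk => ?_
      rw [← mul_assoc, hcoeff k (by simpa [Nat.lt_succ_iff] using hk)]
      ring
    calc (P n).coeff 0 ^ 2 * (detDk ν n n * normS ν n)
        = (-((P n).coeff 0 * detDk ν n n)) * (-((P n).coeff 0 * normS ν n)) := by ring
      _ = detD ν n ^ 2 * ((P n).coeff n *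
          ∑ k ∈ Finset.range (n + 1), (P n).coeff k * rhoSqMoment ν (k + n)) := by
        rw [← hcoeff n le_rfl, ← h1]; ring
      _ = _ := by rw [hnorm, mul_one]
  have hpos : 0 < detDk ν n n * normS ν n := by
    have h1 : 0 < (P n).coeff 0 ^ 2 * (detDk ν n n * normS ν n) := hsq ▸ by positivity
    exact pos_of_mul_pos_right h1 (sq_nonneg _)
  set s := √(detDk ν n n * normS ν n) with hs
  have hs0 : 0 < s := Real.sqrt_pos.2 hpos
  have hss : s ^ 2 = detDk ν n n * normS ν n := Real.sq_sqrt hpos.le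
  -- The sign is forced to be `a_{n,0} √(D_{n,n} S_n) / D_n`, whose square is `1` by `hsq`.
  have hfree : freeCoeff ν n ((P n).coeff 0 * s / detD ν n) = (P n).coeff 0 := by
    rw [freeCoeff, ← hs]
    field_simp
  refine ⟨contDiffOn_rho ν, fun x hx => rho_pos ν hx, hD, hpos, (P n).coeff 0 * s / detD ν n,
    ?_, ?_, hfree.symm, fun x hx => ?_⟩
  · rw [← sq_eq_one_iff, div_pow, mul_pow, hss, hsq, div_self (pow_ne_zero 2 hD)]
  · have h1 : (P n).coeff 0 * s / detD ν n * detDk ν n n = -((P n).coeff n * s) := by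
      have := hcoeff n le_rfl
      field_simp
      linear_combination this
    rw [h1, neg_lt_zero, mul_pos_iff_of_pos_right hs0, leadingCoeff, hdeg]
  · have hr := rho_pos ν hx
    rw [hfree, eval_eq_sum_range, hdeg, Finset.mul_sum]
    refine Finset.sum_congr rfl fun r hr' => ?_
    have h1 := hcoeff r (by simpa [Nat.lt_succ_iff] using hr')
    have h2 := pow_mul_rho_eq_rodrigues (ν := ν) (by linarith) r hx
    rw [mul_assoc (detDk ν n r), mul_assoc (detDk ν n r), ← h2]
    field_simp
    linear_combination h1
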